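/- **Setting.** A Descartes quadruple is a vector $\mathbf q=(a,b,c,d)\in\mathbb R^4$ with $(a+b+c+d)^2=2(a^2+b^2+c^2+d^2)$ and $a+b+c+d>0$ (the curvatures of four mutually tangent circles with disjoint interiors). For $1\le i\le 4$ let $S_i\in \mathrm{GL}(4,\mathbb Z)$ be the move which replaces the $i$-th entry by twice the sum of the other three minus itself, and let $\mathcal A=\langle S_1,S_2,S_3,S_4\rangle$ be the Apollonian group. The curvatures of the Apollonian circle packing generated by $\mathbf q$ are the entries of the vectors $W\mathbf q$, $W\in\mathcal A$. Let $\mathrm{MC}(\mathbf q)$ be the negative of the minimal curvature in this packing if the packing has a circle of non-positive curvature (i.e. is not a full plane packing), and $0$ otherwise. If the first entry of $\mathbf q$ is $n>0$, the height of $\mathbf q$ is $H(\mathbf q)=\mathrm{MC}(\mathbf q)/n$. A depth element $W$ is either a non-identity reduced word in the $S_i$ (no two consecutive letters are equal), with position $j$ defined by its first (leftmost) letter $S_j$, or one of four symbols $\mathrm{Id}_j$, $1\le j\le 4$, with position $j$ and with the empty word as underlying word. $W$ is a depth element of $\mathbf q$ if the circle in position $j$ of $W\mathbf q$ has non-positive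 curvature and the word $W$ is shortest among the reduced words $V$ such that $V\mathbf q$ contains this circle of the packing. (A bounded or half-plane packing has one circle of non-positive curvature, a strip packing has two, a full plane packing has none.) For a Descartes quadruple $\mathbf q=(n,a,b,c)$ put $A=n+a$, $B=n+a+b-c$, $C=n+b$; the principal root of $\mathbf q$ is $p_{\mathbf q}=\frac{-B+2ni}{2A}\in\mathbb P^1(\mathbb C)$ if $A\ne 0$ and $p_{\mathbf q}=\infty$ if $A=0$. Let $D_W=\{p_{\mathbf q}: W\text{ is a depth element of }\mathbf q\}\subseteq\mathbb P^1(\mathbb C)$. The coefficient quadruple of $W$ is the integral quadruple $(t,u,v,w)$ such that the $j$-th entry of $W\mathbf q$ is $-tn+uA+vB+wC$ for all $\mathbf q$, where $j$ is the position of $W$. Let $\mathcal F=\{x+iy: y>0,\ -\tfrac12\le x\le 0,\ x^2+y^2\ge 1\}$ be the fundamental domain for $\mathrm{PGL}(2,\mathbb Z)$ and let $\mu$ be the hyperbolic area $dx\,dy/y^2$. Fix $n>0$. For $p$ in the upper half plane let $\boldsymbol\alpha(p)$ be the unique Descartes quadruple with first entry $n$ and principal root $p$. **Theorem.** Let $W$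 be a depth element with coefficient quadruple $(t,u,v,w)$, and choose $p\in\mathcal F$ uniformly at random with respect to $\mu$. The set of $p$ for which $\boldsymbol\alpha(p)$ has depth element $W$ is measurable, and the probability that $\boldsymbol\alpha(p)$ has depth element $W$ is $$d_W=\begin{cases}0&\text{if }\mu(D_W\cap\mathcal F)=0,\\[2pt] \dfrac3\pi&\text{if }W=\mathrm{Id}_2,\\[4pt] a_W\left(\dfrac{t}{\sqrt{t^2-1}}-1\right)&\text{otherwise,}\end{cases}$$ where $$a_W=\begin{cases}2&\text{if }W=S_1,\\ 6&\text{if }W=(S_4S_1)^k\text{ or }W=S_1(S_4S_1)^k\text{ with }k\ge1,\\ 12&\text{otherwise.}\end{cases}$$ Furthermore, if $\mu(D_W\cap\mathcal F)\neq 0$ and $p$ is chosen uniformly at random in $D_W\cap\mathcal F$ with respect to $\mu$, then $H(\boldsymbol\alpha(p))$ is uniformly distributed on $[0,\,t-\sqrt{t^2-1}]$. -/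

import Mathlib

open MeasureTheory ProbabilityTheory
open scoped UpperHalfPlane

noncomputable section

namespace ApollonianStaircase

/-! ### Descartes quadruples, binary quadratic forms and principal roots

Positions `1, 2, 3, 4` of a quadruple are the indices `0, 1, 2, 3` of `Fin 4`. -/

/-- A (real) Descartes quadruple: the four curvatures of a Descartes configuration.  The quadruples
which satisfy the Descartes equation and have negative sum are the negatives of such, and `0` is
not a quadruple of curvatures. -/
def IsDescartesQuadruple (q : Fin 4 → ℝ) : Prop :=
  (q 0 + q 1 + q 2 + q 3) ^ 2 = 2 * (q 0 ^ 2 + q 1 ^ 2 + q 2 ^ 2 + q 3 ^ 2) ∧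
    0 < q 0 + q 1 + q 2 + q 3

/-- A BQF quadruple `[n, A, B, C]`: a nonzero positive semidefinite binary quadratic form
`A x ^ 2 + B x y + C y ^ 2` of discriminant `-4 n ^ 2`. -/
def IsBQFQuadruple (Q : Fin 4 → ℝ) : Prop :=
  Q ≠ 0 ∧ 0 ≤ Q 1 ∧ 0 ≤ Q 3 ∧ 4 * Q 0 ^ 2 + Q 2 ^ 2 - 4 * Q 1 * Q 3 = 0

/-- `φ (n, a, b, c) = [n, n + a, n + a + b - c, n + b]`. -/
def phi (q : Fin 4 → ℝ) : Fin 4 → ℝ :=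
  ![q 0, q 0 + q 1, q 0 + q 1 + q 2 - q 3, q 0 + q 2]

/-- The integral matrix of `θ [n, A, B, C] = (n, A - n, C - n, A + C - B - n)`. -/
def thetaMat : Matrix (Fin 4) (Fin 4) ℤ :=
  !![1, 0, 0, 0; -1, 1, 0, 0; -1, 0, 0, 1; -1, 1, -1, 1]

/-- `θ [n, A, B, C] = (n, A - n, C - n, A + C - B - n)`. -/
def theta (Q : Fin 4 → ℝ) : Fin 4 → ℝ :=
  (thetaMat.map (Int.cast : ℤ → ℝ)).mulVec Q

lemma theta_eq (Q : Fin 4 → ℝ) :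
    theta Q = ![Q 0, Q 1 - Q 0, Q 3 - Q 0, Q 1 + Q 3 - Q 2 - Q 0] := by
  funext i
  fin_cases i <;>
    simp [theta, thetaMat, Matrix.mulVec, dotProduct, Fin.sum_univ_four] <;> ring

lemma phi_theta (Q : Fin 4 → ℝ) : phi (theta Q) = Q := by
  rw [theta_eq]
  funext i
  fin_cases i <;> (simp [phi]; try ring)

lemma theta_phi (q : Fin 4 → ℝ) : theta (phi q) = q := by
  rw [theta_eq]
  funext i
  fin_cases i <;> (simp [phi]; try ring)

/-- Descartes quadruples are exactly the quadruples that correspond to BQF quadruples. -/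
lemma isDescartesQuadruple_iff (q : Fin 4 → ℝ) :
    IsDescartesQuadruple q ↔ IsBQFQuadruple (phi q) := by
  obtain ⟨Q, rfl⟩ : ∃ Q, q = theta Q := ⟨phi q, (theta_phi q).symm⟩
  rw [phi_theta, theta_eq]
  obtain ⟨n, hn⟩ : ∃ n, n = Q 0 := ⟨_, rfl⟩
  obtain ⟨A, hA⟩ : ∃ A, A = Q 1 := ⟨_, rfl⟩
  obtain ⟨B, hB⟩ : ∃ B, B = Q 2 := ⟨_, rfl⟩
  obtain ⟨C, hC⟩ : ∃ C, C = Q 3 := ⟨_, rfl⟩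
  simp only [IsDescartesQuadruple, IsBQFQuadruple, Matrix.cons_val, ← hn, ← hA, ← hB, ← hC]
  constructor
  · rintro ⟨h1, h2⟩
    have h3 : 4 * n ^ 2 + B ^ 2 - 4 * A * C = 0 := by nlinarith
    have hAC : 0 ≤ A * C := by nlinarith [sq_nonneg n, sq_nonneg B]
    have hpos : 0 < A + C := by
      by_contra hneg
      nlinarith [sq_nonneg (A - C), sq_nonneg (B - 2 * n), sq_nonneg n, sq_nonneg B]
    refine ⟨?_, ?_, ?_, h3⟩
    · intro h0
      rw [h0] at hA hC
      simp only [Pi.zero_apply] at hA hC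
      linarith
    · by_contra hA0
      nlinarith
    · by_contra hC0
      nlinarith
  · rintro ⟨h0, h1, h2, h3⟩
    refine ⟨by nlinarith, ?_⟩
    have hpos : 0 < A + C := by
      by_contra hneg
      have hA0 : A = 0 := by linarith
      have hC0 : C = 0 := by linarith
      have hn0 : n = 0 := by
        have : n ^ 2 = 0 := by rw [hA0] at h3; nlinarith [sq_nonneg n, sq_nonneg B]
        exact pow_eq_zero_iff two_ne_zero |>.1 this
      have hB0 : B = 0 := by
        have : B ^ 2 = 0 := by rw [hA0] at h3; nlinarith [sq_nonneg n, sq_nonneg B]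
        exact pow_eq_zero_iff two_ne_zero |>.1 this
      apply h0
      funext i
      fin_cases i
      · exact hn.symm.trans hn0
      · exact hA.symm.trans hA0
      · exact hB.symm.trans hB0
      · exact hC.symm.trans hC0
    have h4 : (B + 2 * n) ^ 2 < (2 * (A + C)) ^ 2 := by
      have h5 : (B + 2 * n) ^ 2 ≤ 8 * (A * C) := by nlinarith [sq_nonneg (B - 2 * n)]
      have h6 : 0 < (A + C) ^ 2 := by positivity
      nlinarith [sq_nonneg (A - C), mul_nonneg h1 h2]
    have h7 := abs_lt_of_sq_lt_sq h4 (by linarith)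
    linarith [le_abs_self (B + 2 * n)]

/-- The principal root in `ℙ¹(ℂ) = ℂ ∪ {∞}` of a BQF quadruple `[n, A, B, C]`. -/
def principalRoot (Q : Fin 4 → ℝ) : OnePoint ℂ :=
  if Q 1 = 0 then OnePoint.infty
  else (((-(Q 2 : ℂ) + 2 * (Q 0 : ℂ) * Complex.I) / (2 * (Q 1 : ℂ)) : ℂ) : OnePoint ℂ)

/-- The `n`-quadruple `α(p)` which corresponds to a point `p = x + i y` of the upper half plane:
it is `θ [n, A, B, C]` with `A = n / y`, `B = - 2 x n / y`, `C = (x ^ 2 + y ^ 2) n / y`. -/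
def alpha (n : ℝ) (p : ℍ) : Fin 4 → ℝ :=
  theta ![n, n / p.im, -2 * p.re * (n / p.im), (p.re ^ 2 + p.im ^ 2) * (n / p.im)]

/-- For `n > 0`, `α(p)` is the unique Descartes quadruple with first entry `n` whose principal root
is `p`. -/
lemma eq_alpha_iff (n : ℝ) (hn : 0 < n) (p : ℍ) (q : Fin 4 → ℝ) :
    (IsDescartesQuadruple q ∧ q 0 = n ∧ principalRoot (phi q) = ((p : ℂ) : OnePoint ℂ)) ↔
      q = alpha n p := by
  have hy := p.im_pos
  have hA0 : n / p.im ≠ 0 := by positivity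
  constructor
  · rintro ⟨h1, h2, h3⟩
    rw [isDescartesQuadruple_iff] at h1
    obtain ⟨-, -, -, hd⟩ := h1
    have hq0 : phi q 0 = n := h2
    rw [alpha, ← theta_phi q]
    congr 1
    obtain ⟨Q, hQ⟩ : ∃ Q, Q = phi q := ⟨_, rfl⟩
    rw [← hQ] at hd h3 hq0 ⊢
    unfold principalRoot at h3
    split_ifs at h3 with hA
    · exact absurd h3 (OnePoint.infty_ne_coe _)
    rw [OnePoint.coe_eq_coe] at h3
    have hAc : (2 * (Q 1 : ℂ)) ≠ 0 := by simpa using hA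
    rw [div_eq_iff hAc] at h3
    have hre := congrArg Complex.re h3
    have him := congrArg Complex.im h3
    simp at hre him
    have e1 : Q 1 = n / p.im := by
      rw [eq_div_iff hy.ne']; linarith
    have e2 : Q 2 = -2 * p.re * (n / p.im) := by rw [← e1]; linarith
    have e3 : Q 3 = (p.re ^ 2 + p.im ^ 2) * (n / p.im) := by
      have e0 : Q 0 = p.im * Q 1 := by linarith
      have e2' : Q 2 = -2 * p.re * Q 1 := by rw [e1]; exact e2
      rw [← e1]
      rw [e0, e2'] at hd
      apply mul_left_cancel₀ hA
      linarith
    funext i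
    fin_cases i
    · exact hq0
    · exact e1
    · exact e2
    · exact e3
  · rintro rfl
    refine ⟨?_, ?_, ?_⟩
    · rw [isDescartesQuadruple_iff, alpha, phi_theta]
      refine ⟨fun h => hA0 (congrFun h 1), ?_, ?_, ?_⟩
      · simp only [Matrix.cons_val]; positivity
      · simp only [Matrix.cons_val]; positivity
      · simp only [Matrix.cons_val]; field_simp; ring
    · simp [alpha, theta_eq]
    · rw [alpha, phi_theta, principalRoot]
      rw [if_neg (by exact hA0), OnePoint.coe_eq_coe]
      simp only [Matrix.cons_val]
      have hAc : (2 * ((n / p.im : ℝ) : ℂ)) ≠ 0 := by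
        simpa using ⟨hn.ne', hy.ne'⟩
      rw [div_eq_iff hAc]
      apply Complex.ext
      · simp [Complex.div_re]; field_simp
      · simp [Complex.div_im]; field_simp

/-! ### The Apollonian group, depth elements -/

/-- The matrix of the move `S_i`, which replaces the `i`-th curvature by twice the sum of the
others minus itself. -/
def move (i : Fin 4) : Matrix (Fin 4) (Fin 4) ℤ :=
  Matrix.of fun r c => if r = i then (if c = i then -1 else 2) else (if c = r then 1 else 0)

/-- The element `S_{i₁} S_{i₂} ⋯ S_{i_k}` of the Apollonian group given by the word
`[i₁, i₂, …, i_k]`. -/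
def wordMat (w : List (Fin 4)) : Matrix (Fin 4) (Fin 4) ℤ :=
  (w.map move).prod

/-- A word is reduced if no two consecutive letters are equal. -/
def IsReduced (w : List (Fin 4)) : Prop :=
  w.IsChain (· ≠ ·)

/-- The action of a word on a quadruple, `q ↦ W q`. -/
def wordAct (w : List (Fin 4)) (q : Fin 4 → ℝ) : Fin 4 → ℝ :=
  ((wordMat w).map (Int.cast : ℤ → ℝ)).mulVec q

/-- A depth element: one of four integers, `Id_j` being `ident j`, or a non-identity reduced
word. -/
inductive DepthElement : Type
  | ident (j : Fin 4) : DepthElement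
  | word (w : List (Fin 4)) (hne : w ≠ []) (hred : IsReduced w) : DepthElement

namespace DepthElement

/-- The underlying reduced word; it is empty for `Id_j`. -/
def toWord : DepthElement → List (Fin 4)
  | ident _ => []
  | word w _ _ => w

/-- The position of the circle which belongs to the depth element: `j` for `Id_j`, and the `j`
with `S_j` the first letter of a non-identity word. -/
def pos : DepthElement → Fin 4
  | ident j => j
  | word w hne _ => w.head hne

/-- The coefficient quadruple `(t, u, v, w)` of a depth element `W` with position `j`: row `j` of
`W S_θ` is `(-t, u, v, w)`, that is, `(W q)_j = - t n + u A + v B + w C` if `φ(q) = [n, A, B, C]`. -/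
def coeffQuad (W : DepthElement) : Fin 4 → ℤ :=
  ![-(wordMat W.toWord * thetaMat) W.pos 0, (wordMat W.toWord * thetaMat) W.pos 1,
    (wordMat W.toWord * thetaMat) W.pos 2, (wordMat W.toWord * thetaMat) W.pos 3]

/-- The first entry `t` of the coefficient quadruple, as a real number. -/
def t (W : DepthElement) : ℝ := (W.coeffQuad 0 : ℝ)

end DepthElement

/-- The set of all curvatures in the Apollonian circle packing generated by `q`. -/
def curvatures (q : Fin 4 → ℝ) : Set ℝ :=
  {c | ∃ (w : List (Fin 4)) (i : Fin 4), c = wordAct w q i}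

open Classical in
/-- `MC(q)`: the negative of the minimal curvature in the packing generated by `q` if this is not a
full plane packing, and `0` otherwise.  The full plane packings are those without circles of
non-positive curvature (bounded packings have a circle of negative curvature, half-plane and strip
packings have circles of curvature zero). -/
def minCurv (q : Fin 4 → ℝ) : ℝ :=
  if ∃ c ∈ curvatures q, c ≤ 0 then -sInf (curvatures q) else 0

/-- The height `H(q) = MC(q) / n` of an `n`-quadruple `q`. -/
def height (q : Fin 4 → ℝ) : ℝ := minCurv q / q 0

/-- The circle in position `i` of the configuration obtained by applying the word `w` to a starting
Descartes configuration depends only on row `i` of the matrix of `w`, and determines that row (the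
curvature-centre coordinates of the four circles of a Descartes configuration are linearly
independent).  So `c` stands for a circle of the packing, and the word `w` is a shortest reduced
word which moves the starting configuration to a configuration containing that circle. -/
def IsShortestWordTo (c : Fin 4 → ℤ) (w : List (Fin 4)) : Prop :=
  IsReduced w ∧ (∃ i, wordMat w i = c) ∧
    ∀ v : List (Fin 4), IsReduced v → (∃ i, wordMat v i = c) → w.length ≤ v.length

/-- `W` is a depth element of the Descartes quadruple `q`: the circle in position `j = pos W` of
`W q` has non-positive curvature, and the reduced word of `W` is shortest among the words which
reach this circle from `q`.  (A bounded or half-plane packing has one circle of non-positive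
curvature, the strip packing has two of them, each with its own depth element, and a full plane
packing has none.) -/
def HasDepthElement (q : Fin 4 → ℝ) (W : DepthElement) : Prop :=
  wordAct W.toWord q W.pos ≤ 0 ∧ IsShortestWordTo (wordMat W.toWord W.pos) W.toWord

/-- The depth circle `D_W`: the set of principal roots of all Descartes quadruples with depth
element `W`. -/
def depthCircle (W : DepthElement) : Set (OnePoint ℂ) :=
  {z | ∃ q, IsDescartesQuadruple q ∧ HasDepthElement q W ∧ principalRoot (phi q) = z}

/-! ### The fundamental domain and the probabilities

The hyperbolic area `dx dy / y ^ 2` on `ℍ` is Mathlib's `volume`. -/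

/-- The fundamental domain for `PGL(2, ℤ)` bounded by `x = -1/2`, `x = 0`, `x ^ 2 + y ^ 2 = 1`. -/
def fdom : Set ℍ :=
  {p | -1 / 2 ≤ p.re ∧ p.re ≤ 0 ∧ 1 ≤ p.re ^ 2 + p.im ^ 2}

/-- The intersection of the depth circle `D_W` with the fundamental domain. -/
def depthRegion (W : DepthElement) : Set ℍ :=
  {p | ((p : ℂ) : OnePoint ℂ) ∈ depthCircle W} ∩ fdom

open Classical in
/-- `a_W` is `2` if `W = S₁`, it is `6` if `W = (S₄ S₁) ^ k` or `W = S₁ (S₄ S₁) ^ k` with `k ≥ 1`,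
and `12` otherwise. -/
def aCoeff (W : DepthElement) : ℝ :=
  if W.toWord = [0] then 2
  else if ∃ k : ℕ, 1 ≤ k ∧ (W.toWord = (List.replicate k [3, 0]).flatten ∨
      W.toWord = 0 :: (List.replicate k [3, 0]).flatten) then 6
  else 12

open Classical in
/-- The number `d_W`. -/
def depthProb (W : DepthElement) : ℝ :=
  if volume (depthRegion W) = 0 then 0
  else if W = DepthElement.ident 1 then 3 / Real.pi
  else aCoeff W * (W.t / √(W.t ^ 2 - 1) - 1)

end ApollonianStaircase

end

/-!
In the coordinates `[n, A, B, C]` the curvature of a circle of the packing of `α(p)` is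
`-n h(p)` with `h(p) = t - (u - 2 v x + w |p| ^ 2) / y`, where the coefficients come from the row
`r` of the word matrix (`depthFun`).  Two facts turn the theorem into a statement about areas.

* Distinct circles of a packing have disjoint interiors: if the rows `r ≠ s` belong to circles, then
  `r + s` lies in the dual of the light cone, so `r q + s q ≥ 0` for Descartes quadruples `q`
  (`curvature_add_nonneg`).  Hence a non-positive curvature is the minimum of all curvatures, and
  the height equals `h` throughout the depth circle (`height_alpha`).
* Rows satisfy `2 ∑ rᵢ ^ 2 - (∑ rᵢ) ^ 2 = 1`, equivalently `4 u w - 4 v ^ 2 = t ^ 2 - 1`.  So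
  `{h ≥ s}` is a hyperbolic disc whose centre does not depend on `s`, and its area
  `2 π ((t - s) / √(t ^ 2 - 1) - 1)` is affine in `s` (`volume_disc`).

It remains to find the part of the disc which lies in the fundamental domain.  Its sides are mirrors,
and by integrality of `r` a disc either is orthogonal to a mirror, or lies on one side of it:
`x = 0`, `x = -1/2`, `|p| = 1` are orthogonal to the disc when `r₃ = 0`, `r₂ = r₃`, `r₁ = r₂`
respectively.  If the intersection has positive area, then `r₁ ≥ r₂ ≥ r₃ ≥ 0`
(`ineqs_of_volume_ne_zero`).  The pairings `pairing r i` of `r` with the four original circles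
transform under right multiplication by `S_i` as curvatures do, and the last letter of a reduced word
is the position of their strict maximum (`pairing_of_head`).  This allows reading the word off from
the row, and shows that `r₃ ≥ 1`, that `r₂ = r₃` only holds for `S₁`, and that `r₁ = r₂` only holds
for the alternating words in `S₁`, `S₄` which end in `S₁` (`row_classification`).  In these cases
the domain cuts out a sixth (`volume_disc_inter_sixth`) or a half (`volume_disc_inter_half`) of the
disc by the symmetry under reflections, which preserve the area, and in all other cases the disc
lies in the domain.  The area `π / 6` of the domain itself is `volume_fdom`.
-/

noncomputable section

namespace ApollonianStaircase

/-! ### Rows of word matrices and disjointness of circles -/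

/-- The Lorentzian pairing of the row `r` with the circle in position `i` of the starting
configuration, normalised to be `-1` when `r` is that circle itself and `1` when it is another circle
of the configuration.  Values of at least `1` mean that the two circles have disjoint interiors. -/
def pairing (r : Fin 4 → ℤ) (i : Fin 4) : ℤ := (∑ j, r j) - 2 * r i

lemma wordMat_append (v w : List (Fin 4)) : wordMat (v ++ w) = wordMat v * wordMat w := by
  simp [wordMat]

lemma wordMat_cons (a : Fin 4) (w : List (Fin 4)) : wordMat (a :: w) = move a * wordMat w := by
  simp [wordMat]

lemma wordMat_append_singleton (w : List (Fin 4)) (a : Fin 4) :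
    wordMat (w ++ [a]) = wordMat w * move a := by
  simp [wordMat]

/-- Right multiplication by a move, on the entries of a row. -/
lemma mul_move_apply (M : Matrix (Fin 4) (Fin 4) ℤ) (a i l : Fin 4) :
    (M * move a) i l = if l = a then -M i a else M i l + 2 * M i a := by
  fin_cases a <;> fin_cases l <;>
    simp [Matrix.mul_apply, move, Fin.sum_univ_four] <;> ring

lemma move_mul_row_of_ne (M : Matrix (Fin 4) (Fin 4) ℤ) {a i : Fin 4} (h : i ≠ a) :
    (move a * M) i = M i := by
  funext l
  simp [Matrix.mul_apply, move, h]

lemma move_mul_move (a : Fin 4) : move a * move a = 1 := by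
  fin_cases a <;> decide

lemma wordMat_mul_reverse (w : List (Fin 4)) : wordMat w * wordMat w.reverse = 1 := by
  induction w with
  | nil => simp [wordMat]
  | cons a w ih =>
    rw [List.reverse_cons, wordMat_append_singleton, wordMat_cons, Matrix.mul_assoc,
      ← Matrix.mul_assoc (wordMat w), ih, Matrix.one_mul, move_mul_move]

lemma pairing_mul_move_of_ne (M : Matrix (Fin 4) (Fin 4) ℤ) {a l : Fin 4} (i : Fin 4)
    (h : l ≠ a) : pairing ((M * move a) i) l = pairing (M i) l := by
  fin_cases a <;> fin_cases l <;>
    first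
    | exact absurd rfl h
    | simp [pairing, mul_move_apply, Fin.sum_univ_four]; ring

lemma pairing_mul_move_self (M : Matrix (Fin 4) (Fin 4) ℤ) (a i : Fin 4) :
    pairing ((M * move a) i) a = 2 * (∑ l, pairing (M i) l) - 3 * pairing (M i) a := by
  fin_cases a <;>
    simp [pairing, mul_move_apply, Fin.sum_univ_four] <;> ring

/-- Every circle has norm one for the dual Descartes form. -/
lemma row_form_eq_one (w : List (Fin 4)) (i : Fin 4) :
    2 * ∑ l, wordMat w i l ^ 2 - (∑ l, wordMat w i l) ^ 2 = 1 := by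
  induction w using List.reverseRecOn with
  | nil => fin_cases i <;> simp [wordMat, Fin.sum_univ_four]
  | append_singleton w a ih =>
    rw [wordMat_append_singleton, ← ih]
    fin_cases a <;> simp [mul_move_apply, Fin.sum_univ_four] <;> ring

lemma isReduced_append_singleton {v : List (Fin 4)} {a b : Fin 4} :
    IsReduced (v ++ [a] ++ [b]) ↔ IsReduced (v ++ [a]) ∧ a ≠ b := by
  simp only [IsReduced, List.isChain_append, List.append_assoc]
  simp
  tauto

/-- For the row of the circle created by the first letter of a reduced word with last letter `l`: the
pairings with the starting circles are positive, and position `l` is their strict maximum.  Appending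
a letter `m ≠ l` replaces the `m`-th pairing by twice the sum of the others minus itself, which is
larger than the previous maximum. -/
lemma pairing_of_head (w : List (Fin 4)) (l j : Fin 4) (hw : IsReduced (w ++ [l]))
    (hj : (w ++ [l]).head? = some j) :
    (∀ m, 1 ≤ pairing (wordMat (w ++ [l]) j) m) ∧
      (∀ m, m ≠ l → pairing (wordMat (w ++ [l]) j) m < pairing (wordMat (w ++ [l]) j) l) ∧
      wordMat (w ++ [l]) j l < 0 := by
  induction w using List.reverseRecOn generalizing l with
  | nil =>
    obtain rfl : l = j := by simpa using hj
    fin_cases l <;> decide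
  | append_singleton w a ih =>
    obtain ⟨h1, hal⟩ := isReduced_append_singleton.1 hw
    obtain ⟨hpos, hmax, -⟩ := ih a h1 (by cases w <;> simpa using hj)
    rw [wordMat_append_singleton]
    set M := wordMat (w ++ [a])
    have hself := pairing_mul_move_self M l j
    have hlt : pairing (M j) a < pairing ((M * move l) j) l := by
      have h2 := hmax l hal.symm
      rw [hself, Fin.sum_univ_four]
      have p0 := hpos 0
      have p1 := hpos 1
      have p2 := hpos 2
      have p3 := hpos 3
      fin_cases a <;> fin_cases l <;> first | exact absurd rfl hal | (simp at *; linarith)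
    have hlt' : ∀ m, m ≠ l → pairing ((M * move l) j) m < pairing ((M * move l) j) l := by
      intro m hm
      rw [pairing_mul_move_of_ne M j hm]
      rcases eq_or_ne m a with rfl | hma
      · exact hlt
      · exact (hmax m hma).trans hlt
    refine ⟨fun m => ?_, hlt', ?_⟩
    swap
    · have h2 := (hmax l hal.symm).trans hlt
      rw [mul_move_apply, if_pos rfl]
      simp only [pairing, mul_move_apply, Fin.sum_univ_four] at h2 ⊢
      fin_cases l <;> simp at h2 ⊢ <;> linarith
    rcases eq_or_ne m l with rfl | hm
    · exact (hpos a).trans hlt.le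
    · rw [pairing_mul_move_of_ne M j hm]
      exact hpos m

/-- Cancelling equal neighbours turns each word into a reduced one with the same matrix. -/
lemma exists_isReduced (w : List (Fin 4)) : ∃ v, IsReduced v ∧ wordMat v = wordMat w := by
  induction w with
  | nil => exact ⟨[], by simp [IsReduced], rfl⟩
  | cons a w ih =>
    obtain ⟨v, hv, hvw⟩ := ih
    rcases v with _ | ⟨b, v⟩
    · exact ⟨[a], by simp [IsReduced], by rw [wordMat_cons, wordMat_cons, hvw]⟩
    · rcases eq_or_ne a b with rfl | hab
      · refine ⟨v, List.IsChain.of_cons hv, ?_⟩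
        rw [wordMat_cons, ← hvw, wordMat_cons, ← Matrix.mul_assoc, move_mul_move, Matrix.one_mul]
      · exact ⟨a :: b :: v, List.isChain_cons_cons.2 ⟨hab, hv⟩,
          by rw [wordMat_cons, hvw, wordMat_cons]⟩

/-- A circle of the packing is one of the four starting circles, or it is disjoint from or externally
tangent to each of them. -/
lemma row_dichotomy (w : List (Fin 4)) (i : Fin 4) :
    (∃ j, wordMat w i = (1 : Matrix (Fin 4) (Fin 4) ℤ) j) ∨
      ∀ m, 1 ≤ pairing (wordMat w i) m := by
  obtain ⟨v, hv, hvw⟩ := exists_isReduced w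
  rw [← hvw]
  clear hvw
  induction v with
  | nil => exact Or.inl ⟨i, by simp [wordMat]⟩
  | cons a v ih =>
    rcases eq_or_ne i a with rfl | hia
    · right
      obtain ⟨u, l, hul⟩ : ∃ u l, i :: v = u ++ [l] :=
        ⟨_, _, (List.dropLast_append_getLast (List.cons_ne_nil i v)).symm⟩
      rw [hul] at hv ⊢
      exact (pairing_of_head u l i hv (by rw [← hul]; rfl)).1
    · rw [wordMat_cons, move_mul_row_of_ne _ hia]
      exact ih (List.IsChain.of_cons hv)

/-- Vectors in the cone `2 ∑ sᵢ ^ 2 ≤ (∑ sᵢ) ^ 2`, `0 ≤ ∑ sᵢ` make an angle of at most `π / 4` with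
`(1, 1, 1, 1)`, so any two of them have a nonnegative inner product. -/
lemma cone_dual (s q : Fin 4 → ℝ) (hs : 2 * ∑ l, s l ^ 2 ≤ (∑ l, s l) ^ 2)
    (hs0 : 0 ≤ ∑ l, s l) (hq : 2 * ∑ l, q l ^ 2 ≤ (∑ l, q l) ^ 2) (hq0 : 0 ≤ ∑ l, q l) :
    0 ≤ ∑ l, s l * q l := by
  have hcs := Finset.sum_mul_sq_le_sq_mul_sq Finset.univ
    (fun l => s l - (∑ l, s l) / 4) (fun l => q l - (∑ l, q l) / 4)
  simp only [Fin.sum_univ_four] at *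
  set a := s 0 + s 1 + s 2 + s 3
  set b := q 0 + q 1 + q 2 + q 3
  have e1 : (s 0 - a / 4) ^ 2 + (s 1 - a / 4) ^ 2 + (s 2 - a / 4) ^ 2 + (s 3 - a / 4) ^ 2
      ≤ a ^ 2 / 4 := by
    have : a = s 0 + s 1 + s 2 + s 3 := rfl
    nlinarith
  have e2 : (q 0 - b / 4) ^ 2 + (q 1 - b / 4) ^ 2 + (q 2 - b / 4) ^ 2 + (q 3 - b / 4) ^ 2
      ≤ b ^ 2 / 4 := by
    have : b = q 0 + q 1 + q 2 + q 3 := rfl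
    nlinarith
  have h1 := hcs.trans (mul_le_mul e1 e2 (by positivity) (by positivity))
  rw [show a ^ 2 / 4 * (b ^ 2 / 4) = (a * b / 4) ^ 2 by ring] at h1
  have h2 := neg_le_of_abs_le (abs_le_of_sq_le_sq h1 (by positivity))
  have ha : a = s 0 + s 1 + s 2 + s 3 := rfl
  have hb : b = q 0 + q 1 + q 2 + q 3 := rfl
  have h3 : (s 0 - a / 4) * (q 0 - b / 4) + (s 1 - a / 4) * (q 1 - b / 4) +
      (s 2 - a / 4) * (q 2 - b / 4) + (s 3 - a / 4) * (q 3 - b / 4)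
      = s 0 * q 0 + s 1 * q 1 + s 2 * q 2 + s 3 * q 3 - a * b / 4 := by
    rw [ha, hb]; ring
  linarith

lemma wordAct_apply (w : List (Fin 4)) (q : Fin 4 → ℝ) (i : Fin 4) :
    wordAct w q i = ∑ l, (wordMat w i l : ℝ) * q l := by
  simp [wordAct, Matrix.mulVec, dotProduct]

lemma wordAct_append (v w : List (Fin 4)) (q : Fin 4 → ℝ) :
    wordAct (v ++ w) q = wordAct v (wordAct w q) := by
  have h := Matrix.map_mul_intCast (α := ℝ) (wordMat v) (wordMat w)
  rw [wordAct, wordAct, wordAct, wordMat_append, Matrix.mulVec_mulVec, h]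

/-- The Apollonian group preserves Descartes quadruples, including the positivity of their sum. -/
lemma IsDescartesQuadruple.wordAct {q : Fin 4 → ℝ} (hq : IsDescartesQuadruple q)
    (w : List (Fin 4)) : IsDescartesQuadruple (wordAct w q) := by
  induction w with
  | nil => simpa [ApollonianStaircase.wordAct, wordMat] using hq
  | cons a w ih =>
    rw [← List.singleton_append, wordAct_append]
    obtain ⟨h1, h2⟩ := ih
    generalize ApollonianStaircase.wordAct w q = x at h1 h2
    -- a move changes the sum `s` to `3 s - 4 b`, and the Descartes equation bounds `b` by
    -- `(1 + √3) / 4 * s < 3 / 4 * s`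
    have key : ∀ b c d e : ℝ, (b + c + d + e) ^ 2 = 2 * (b ^ 2 + c ^ 2 + d ^ 2 + e ^ 2) →
        0 < b + c + d + e → 0 < 3 * (b + c + d + e) - 4 * b := by
      intro b c d e h h'
      by_contra hcon
      nlinarith [sq_nonneg (c - d), sq_nonneg (d - e), sq_nonneg (c - e)]
    constructor
    · fin_cases a <;>
        simp [wordAct_apply, wordMat, move, Fin.sum_univ_four] <;> nlinarith
    · fin_cases a
      · have := key (x 0) (x 1) (x 2) (x 3) h1 h2
        simp [wordAct_apply, wordMat, move, Fin.sum_univ_four]; linarith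
      · have := key (x 1) (x 0) (x 2) (x 3) (by linarith) (by linarith)
        simp [wordAct_apply, wordMat, move, Fin.sum_univ_four]; linarith
      · have := key (x 2) (x 0) (x 1) (x 3) (by linarith) (by linarith)
        simp [wordAct_apply, wordMat, move, Fin.sum_univ_four]; linarith
      · have := key (x 3) (x 0) (x 1) (x 2) (by linarith) (by linarith)
        simp [wordAct_apply, wordMat, move, Fin.sum_univ_four]; linarith

/-- A circle of the packing other than the starting circle `j` has disjoint interior from it, so the
two curvatures have a nonnegative sum. -/
lemma curvature_add_nonneg {q : Fin 4 → ℝ} (hq : IsDescartesQuadruple q) (w : List (Fin 4))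
    (i j : Fin 4) (hij : wordMat w i ≠ (1 : Matrix (Fin 4) (Fin 4) ℤ) j) :
    0 ≤ wordAct w q i + q j := by
  have hform := row_form_eq_one w i
  have hpair : 1 ≤ pairing (wordMat w i) j ∧ 0 ≤ ∑ l, wordMat w i l := by
    rcases row_dichotomy w i with ⟨k, hk⟩ | h
    · have hkj : k ≠ j := by rintro rfl; exact hij hk
      rw [hk]
      clear hk hij hform hq
      revert k j
      decide
    · refine ⟨h j, ?_⟩
      have h0 := h 0
      have h1 := h 1
      have h2 := h 2
      have h3 := h 3
      simp only [pairing, Fin.sum_univ_four] at *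
      linarith
  obtain ⟨hp, hs⟩ := hpair
  have hcone := cone_dual (fun l => (wordMat w i l : ℝ) + if l = j then 1 else 0) q ?_ ?_
    (by simp only [Fin.sum_univ_four]; exact hq.1.symm.le)
    (by simp only [Fin.sum_univ_four]; exact hq.2.le)
  · rw [wordAct_apply]
    simpa [add_mul, Finset.sum_add_distrib] using hcone
  · have h1 : (2 * ∑ l, (wordMat w i l + if l = j then 1 else 0) ^ 2 : ℤ) ≤
        (∑ l, (wordMat w i l + if l = j then 1 else 0)) ^ 2 := by
      simp only [pairing] at hp
      simp only [add_sq, Finset.sum_add_distrib, Finset.sum_ite_eq', Finset.mem_univ, if_true,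
        ite_pow, one_pow, mul_ite, mul_one, mul_zero, zero_pow two_ne_zero]
      linarith
    exact_mod_cast h1
  · have h1 : (0 : ℤ) ≤ ∑ l, (wordMat w i l + if l = j then 1 else 0) := by
      simp only [Finset.sum_add_distrib, Finset.sum_ite_eq', Finset.mem_univ, if_true]
      linarith
    exact_mod_cast h1

/-- A non-positive curvature is minimal in the packing. -/
lemma isLeast_curvatures {q : Fin 4 → ℝ} (hq : IsDescartesQuadruple q) (w : List (Fin 4))
    (j : Fin 4) (h : wordAct w q j ≤ 0) : IsLeast (curvatures q) (wordAct w q j) := by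
  refine ⟨⟨w, j, rfl⟩, ?_⟩
  rintro _ ⟨v, i, rfl⟩
  -- express the circle relative to the configuration `w q`
  have hv : wordAct v q i = wordAct (v ++ w.reverse) (wordAct w q) i := by
    have h1 : wordMat (v ++ w.reverse ++ w) = wordMat v := by
      have h2 := wordMat_mul_reverse w.reverse
      rw [List.reverse_reverse] at h2
      rw [List.append_assoc, wordMat_append, wordMat_append, h2, Matrix.mul_one]
    rw [← wordAct_append, wordAct, wordAct, h1]
  rw [hv]
  by_cases hij : wordMat (v ++ w.reverse) i = (1 : Matrix (Fin 4) (Fin 4) ℤ) j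
  · rw [wordAct_apply (v ++ w.reverse), hij]
    simp [Matrix.one_apply]
  · linarith [curvature_add_nonneg (hq.wordAct w) _ i j hij]

lemma minCurv_eq {q : Fin 4 → ℝ} (hq : IsDescartesQuadruple q) (w : List (Fin 4))
    (j : Fin 4) (h : wordAct w q j ≤ 0) : minCurv q = -wordAct w q j := by
  have hl := isLeast_curvatures hq w j h
  rw [minCurv, if_pos ⟨_, hl.1, h⟩, hl.csInf_eq]

/-! ### Reading a word off from its row -/

/-- The equality of two pairings persists when the last letter is deleted, and it forbids the letters
`1` and `2`, which would make one of these pairings the strict maximum. -/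
lemma letters_of_pairing_eq {v : List (Fin 4)} {l j : Fin 4} (hw : IsReduced (v ++ [l]))
    (hj : (v ++ [l]).head? = some j)
    (h : pairing (wordMat (v ++ [l]) j) 1 = pairing (wordMat (v ++ [l]) j) 2) :
    ∀ a ∈ v ++ [l], a = 0 ∨ a = 3 := by
  induction v using List.reverseRecOn generalizing l with
  | nil =>
    obtain rfl : l = j := by simpa using hj
    clear hw hj
    revert l
    decide
  | append_singleton v a ih =>
    obtain ⟨-, hmax, -⟩ := pairing_of_head _ _ _ hw hj
    have h1 : l ≠ 1 := by rintro rfl; exact (hmax 2 (by decide)).ne h.symm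
    have h2 : l ≠ 2 := by rintro rfl; exact (hmax 1 (by decide)).ne h
    have hl : l = 0 ∨ l = 3 := by clear * - h1 h2; revert l; decide
    rw [wordMat_append_singleton, pairing_mul_move_of_ne _ _ h1.symm,
      pairing_mul_move_of_ne _ _ h2.symm] at h
    have := ih (isReduced_append_singleton.1 hw).1 (by cases v <;> simpa using hj) h
    intro b hb
    rcases List.mem_append.1 hb with hb | hb
    · exact this b hb
    · rw [List.mem_singleton.1 hb]; exact hl

lemma row_one_eq_two_of_letters {w : List (Fin 4)} (hw : ∀ a ∈ w, a = 0 ∨ a = 3) {i : Fin 4}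
    (hi : i = 0 ∨ i = 3) : wordMat w i 1 = wordMat w i 2 := by
  induction w using List.reverseRecOn with
  | nil => rcases hi with rfl | rfl <;> simp [wordMat]
  | append_singleton w a ih =>
    have h1 := ih fun b hb => hw b (List.mem_append_left _ hb)
    rw [wordMat_append_singleton, mul_move_apply, mul_move_apply, h1]
    rcases hw a (by simp) with rfl | rfl <;> simp

/-- The reduced words in `S₁` and `S₄` that end in `S₁`. -/
lemma alternating_of_letters (v : List (Fin 4)) (hv : IsReduced (v ++ [0]))
    (h : ∀ a ∈ v, a = 0 ∨ a = 3) :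
    ∃ k : ℕ, v ++ [0] = (List.replicate k [3, 0]).flatten ∨
      v ++ [0] = 0 :: (List.replicate k [3, 0]).flatten := by
  induction v with
  | nil => exact ⟨0, Or.inr (by simp)⟩
  | cons a v ih =>
    obtain ⟨k, hk⟩ := ih (List.IsChain.of_cons hv) fun b hb => h b (List.mem_cons_of_mem _ hb)
    rw [List.cons_append] at hv ⊢
    have ha := h a (by simp)
    rcases hk with hk | hk
    · rw [hk] at hv ⊢
      rcases k with _ | k
      · simp at hk
      · rw [List.replicate_succ, List.flatten_cons] at hv
        have h3 : a ≠ 3 := (List.isChain_cons_cons.1 hv).1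
        exact ⟨k + 1, Or.inr (by rw [ha.resolve_right h3])⟩
    · rw [hk] at hv ⊢
      have h0 : a ≠ 0 := (List.isChain_cons_cons.1 hv).1
      exact ⟨k + 1, Or.inl (by rw [ha.resolve_left h0, List.replicate_succ]; rfl)⟩

/-- Reduced words whose row satisfies `r₁ ≥ r₂ ≥ r₃ ≥ 0` end in `S₁`, because the entry at the last
letter is negative.  The cases of equality are those of discs orthogonal to a side of the fundamental
domain. -/
lemma row_classification {w : List (Fin 4)} (hw : IsReduced w) {j : Fin 4}
    (hj : w.head? = some j) (h12 : wordMat w j 2 ≤ wordMat w j 1)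
    (h23 : wordMat w j 3 ≤ wordMat w j 2) (h3 : 0 ≤ wordMat w j 3) :
    1 ≤ wordMat w j 3 ∧ (wordMat w j 2 = wordMat w j 3 → w = [0]) ∧
      (wordMat w j 1 = wordMat w j 2 → w ≠ [0] → ∃ k : ℕ, 1 ≤ k ∧
        (w = (List.replicate k [3, 0]).flatten ∨ w = 0 :: (List.replicate k [3, 0]).flatten)) := by
  obtain ⟨v, l, rfl⟩ : ∃ u l, w = u ++ [l] := by
    have hne : w ≠ [] := by rintro rfl; simp at hj
    exact ⟨_, _, (List.dropLast_append_getLast hne).symm⟩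
  obtain ⟨hpos, hmax, hneg⟩ := pairing_of_head _ _ _ hw hj
  obtain rfl : l = 0 := by
    have key : ∀ x : Fin 4 → ℤ, x 2 ≤ x 1 → x 3 ≤ x 2 → 0 ≤ x 3 → ∀ m, x m < 0 → m = 0 := by
      intro x h1 h2 h3 m hm
      fin_cases m <;> simp at * <;> omega
    exact key _ h12 h23 h3 l hneg
  refine ⟨?_, ?_, ?_⟩
  · -- if `r₃ = 0`, the form is `-(X Y + Y Z + Z X)` in the pairings `X, Y, Z ≥ 1` at `0, 1, 2`
    rcases h3.lt_or_eq with h | h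
    · exact h
    · exfalso
      have hform := row_form_eq_one (v ++ [0]) j
      have h0 := hpos 0
      have h1 := hpos 1
      have h2 := hpos 2
      simp only [pairing, Fin.sum_univ_four, ← h] at hform h0 h1 h2
      nlinarith
  · -- a further letter `1`, `2` or `3` before the final `0` would be the position of a strict maximum
    -- of the pairings, but these satisfy `pairing 1 ≤ pairing 2 = pairing 3`
    intro h
    rcases v.eq_nil_or_concat with rfl | ⟨u, a, rfl⟩
    · rfl
    · exfalso
      rw [List.concat_eq_append] at *
      obtain ⟨hu, ha⟩ := isReduced_append_singleton.1 hw
      obtain ⟨-, hmax', -⟩ := pairing_of_head u a j hu (by cases u <;> simpa using hj)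
      rw [wordMat_append_singleton _ 0] at h h12
      rw [mul_move_apply, mul_move_apply] at h h12
      simp at h h12
      have e1 := hmax' 1
      have e2 := hmax' 2
      have e3 := hmax' 3
      simp only [pairing] at e1 e2 e3
      fin_cases a <;> simp at * <;> omega
  · intro h hne
    obtain ⟨k, hk⟩ := alternating_of_letters v hw fun a ha =>
      letters_of_pairing_eq hw hj (by simp only [pairing, h]) a (List.mem_append_left _ ha)
    refine ⟨k, ?_, hk⟩
    by_contra hk0
    obtain rfl : k = 0 := by omega
    rcases hk with hk | hk
    · simp at hk
    · exact hne (by simpa using hk)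

/-- The normalised co-curvature `h(p) = t - (u - 2 v x + w |p| ^ 2) / y` of the circle with row `r`:
its curvature in the packing of `α(p)` is `-n h(p)`.  The coefficients are `t = r₁ + r₂ + r₃ - r₀`,
`u = r₁ + r₃`, `v = -r₃` and `w = r₂ + r₃`. -/
def depthFun (r : Fin 4 → ℤ) (p : ℍ) : ℝ :=
  ((r 1 + r 2 + r 3 - r 0 : ℤ) : ℝ) -
    ((r 1 + r 3 : ℤ) + 2 * r 3 * p.re + (r 2 + r 3 : ℤ) * (p.re ^ 2 + p.im ^ 2)) / p.im

lemma wordAct_alpha (n : ℝ) (p : ℍ) (w : List (Fin 4)) (j : Fin 4) :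
    wordAct w (alpha n p) j = -(n * depthFun (wordMat w j) p) := by
  have := p.im_pos.ne'
  rw [wordAct_apply, alpha, theta_eq, depthFun]
  simp [Fin.sum_univ_four]
  field_simp
  ring

lemma isDescartesQuadruple_alpha {n : ℝ} (hn : 0 < n) (p : ℍ) :
    IsDescartesQuadruple (alpha n p) :=
  ((eq_alpha_iff n hn p _).2 rfl).1

lemma hasDepthElement_alpha {n : ℝ} (hn : 0 < n) (p : ℍ) (W : DepthElement) :
    HasDepthElement (alpha n p) W ↔ 0 ≤ depthFun (wordMat W.toWord W.pos) p ∧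
      IsShortestWordTo (wordMat W.toWord W.pos) W.toWord := by
  rw [HasDepthElement, wordAct_alpha, neg_nonpos, mul_nonneg_iff_of_pos_left hn]

lemma height_alpha {n : ℝ} (hn : 0 < n) (p : ℍ) (w : List (Fin 4)) (j : Fin 4)
    (h : 0 ≤ depthFun (wordMat w j) p) :
    height (alpha n p) = depthFun (wordMat w j) p := by
  have h0 : alpha n p 0 = n := ((eq_alpha_iff n hn p _).2 rfl).2.1
  rw [height, minCurv_eq (isDescartesQuadruple_alpha hn p) w j, wordAct_alpha, h0, neg_neg,
    mul_div_cancel_left₀ _ hn.ne']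
  rw [wordAct_alpha, neg_nonpos]
  positivity

/-- A quadruple with principal root in the upper half plane is `α(p)` for some positive `n`.  The first
entry is not prescribed in the definition of the depth circle. -/
lemma exists_eq_alpha {q : Fin 4 → ℝ} (hq : IsDescartesQuadruple q) (p : ℍ)
    (h : principalRoot (phi q) = ((p : ℂ) : OnePoint ℂ)) : ∃ m : ℝ, 0 < m ∧ q = alpha m p := by
  refine ⟨q 0, ?_, (eq_alpha_iff _ ?_ p q).1 ⟨hq, rfl, h⟩⟩
  all_goals
    have hb := (isDescartesQuadruple_iff q).1 hq
    rw [principalRoot] at h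
    split_ifs at h with hA
    · exact absurd h (OnePoint.infty_ne_coe _)
    · have hA' : 0 < phi q 1 := lt_of_le_of_ne hb.2.1 (Ne.symm hA)
      rw [OnePoint.coe_eq_coe, div_eq_iff (by simpa using hA)] at h
      have him := congrArg Complex.im h
      simp at him
      have : phi q 0 = q 0 := rfl
      have := mul_pos p.im_pos hA'
      linarith

lemma mem_depthCircle (p : ℍ) (W : DepthElement) :
    ((p : ℂ) : OnePoint ℂ) ∈ depthCircle W ↔ 0 ≤ depthFun (wordMat W.toWord W.pos) p ∧
      IsShortestWordTo (wordMat W.toWord W.pos) W.toWord := by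
  constructor
  · rintro ⟨q, hq, hW, hp⟩
    obtain ⟨m, hm, rfl⟩ := exists_eq_alpha hq p hp
    exact (hasDepthElement_alpha hm p W).1 hW
  · intro h
    exact ⟨alpha 1 p, isDescartesQuadruple_alpha one_pos p, (hasDepthElement_alpha one_pos p W).2 h,
      ((eq_alpha_iff 1 one_pos p _).2 rfl).2.2⟩

lemma t_eq (W : DepthElement) :
    W.t = ((wordMat W.toWord W.pos 1 + wordMat W.toWord W.pos 2 + wordMat W.toWord W.pos 3 -
      wordMat W.toWord W.pos 0 : ℤ) : ℝ) := by
  simp only [DepthElement.t, DepthElement.coeffQuad, Matrix.mul_apply, thetaMat,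
    Fin.sum_univ_four]
  simp
  ring

/-! ### Hyperbolic areas -/

/-- Hyperbolic area by integration over vertical lines. -/
lemma volume_eq_lintegral_fibers {S : Set (ℝ × ℝ)} (hS : MeasurableSet S) :
    volume {p : ℍ | (p.re, p.im) ∈ S} =
      ∫⁻ x : ℝ, ∫⁻ y in {y | 0 < y ∧ (x, y) ∈ S}, ENNReal.ofReal (1 / y ^ 2) := by
  set T : Set (ℝ × ℝ) := {z | 0 < z.2 ∧ z ∈ S} with hT
  have hTm : MeasurableSet T := (measurableSet_lt measurable_const measurable_snd).inter hS
  have himg : ((↑) : ℍ → ℂ) '' {p : ℍ | (p.re, p.im) ∈ S} =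
      Complex.measurableEquivRealProd ⁻¹' T := by
    ext z
    constructor
    · rintro ⟨p, hp, rfl⟩
      exact ⟨p.im_pos, hp⟩
    · rintro ⟨h1, h2⟩
      exact ⟨⟨z, h1⟩, h2, rfl⟩
  have hf : Measurable fun z : ℝ × ℝ => ENNReal.ofReal (1 / z.2 ^ 2) := by fun_prop
  rw [UpperHalfPlane.volume_eq_lintegral, himg]
  have h1 := Complex.volume_preserving_equiv_real_prod.setLIntegral_comp_preimage hTm hf
  have h2 : ∀ z : ℂ, (((1 / ‖z.im‖₊) ^ 2 : NNReal) : ENNReal) =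
      ENNReal.ofReal (1 / (Complex.measurableEquivRealProd z).2 ^ 2) := by
    intro z
    rw [ENNReal.ofReal, ENNReal.coe_inj]
    ext
    rw [Real.coe_toNNReal _ (by positivity)]
    simp
  simp only [h2]
  rw [h1, ← lintegral_indicator hTm, Measure.volume_eq_prod,
    lintegral_prod _ (hf.indicator hTm).aemeasurable]
  refine lintegral_congr fun x => ?_
  rw [← lintegral_indicator]
  · rfl
  · exact hTm.preimage measurable_prodMk_left

lemma lintegral_inv_sq_Icc {a b : ℝ} (ha : 0 < a) (hab : a ≤ b) :
    ∫⁻ y in Set.Icc a b, ENNReal.ofReal (1 / y ^ 2) = ENNReal.ofReal (1 / a - 1 / b) := by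
  have hpos : ∀ y ∈ Set.uIcc a b, y ≠ 0 := by
    intro y hy
    rw [Set.uIcc_of_le hab] at hy
    exact (ha.trans_le hy.1).ne'
  have hcont : ContinuousOn (fun y : ℝ => 1 / y ^ 2) (Set.uIcc a b) :=
    continuousOn_const.div (by fun_prop) fun y hy => pow_ne_zero 2 (hpos y hy)
  have hint : IntervalIntegrable (fun y : ℝ => 1 / y ^ 2) volume a b := hcont.intervalIntegrable
  rw [← restrict_Ioc_eq_restrict_Icc, ← ofReal_integral_eq_lintegral_ofReal hint.1
    (Filter.Eventually.of_forall fun y => by positivity), ← intervalIntegral.integral_of_le hab,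
    intervalIntegral.integral_eq_sub_of_hasDerivAt (f := fun y : ℝ => -(1 / y)) _ hint]
  · congr 1; ring
  · intro y hy
    simp only [one_div]
    exact (hasDerivAt_inv (hpos y hy)).fun_neg.congr_deriv (neg_neg _)

lemma lintegral_inv_sq_Ici {a : ℝ} (ha : 0 < a) :
    ∫⁻ y in Set.Ici a, ENNReal.ofReal (1 / y ^ 2) = ENNReal.ofReal (1 / a) := by
  have hderiv : ∀ y ∈ Set.Ioi a, HasDerivAt (fun y : ℝ => -(1 / y)) (1 / y ^ 2) y := by
    intro y hy
    simp only [one_div]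
    exact (hasDerivAt_inv (ha.trans hy).ne').fun_neg.congr_deriv (neg_neg _)
  have hcont : ContinuousWithinAt (fun y : ℝ => -(1 / y)) (Set.Ici a) a := by
    have : ContinuousAt (fun y : ℝ => -(1 / y)) a :=
      (continuousAt_const.div continuousAt_id ha.ne').neg
    exact this.continuousWithinAt
  have hlim : Filter.Tendsto (fun y : ℝ => -(1 / y)) Filter.atTop (nhds 0) := by
    have := (tendsto_inv_atTop_zero (𝕜 := ℝ)).neg
    simpa [one_div] using this
  have hpos : ∀ y ∈ Set.Ioi a, 0 ≤ 1 / y ^ 2 := fun y _ => by positivity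
  have hint := integrableOn_Ioi_deriv_of_nonneg hcont hderiv hpos hlim
  rw [← restrict_Ioi_eq_restrict_Ici, ← ofReal_integral_eq_lintegral_ofReal hint
    (Filter.Eventually.of_forall fun y => by positivity),
    integral_Ioi_of_hasDerivAt_of_nonneg hcont hderiv hpos hlim]
  congr 1; ring

/-- The closed hyperbolic disc with hyperbolic centre `x₀ + i k` and Euclidean centre `x₀ + i y₀`; its
radius is the inverse hyperbolic cosine of `y₀ / k`. -/
def disc (x₀ k y₀ : ℝ) : Set ℍ :=
  {p | (p.re - x₀) ^ 2 + p.im ^ 2 + k ^ 2 ≤ 2 * y₀ * p.im}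

/-- The integral of `1 / y₋ - 1 / y₊` over the vertical chords of a disc with Euclidean radius `R`. -/
lemma integral_chord {R k : ℝ} (hR : 0 < R) (hk : 0 < k) :
    IntervalIntegrable (fun z => 2 * √(R ^ 2 - z ^ 2) / (z ^ 2 + k ^ 2)) volume (-R) R ∧
    ∫ z in (-R)..R, 2 * √(R ^ 2 - z ^ 2) / (z ^ 2 + k ^ 2) =
      2 * Real.pi * (√(R ^ 2 + k ^ 2) / k - 1) := by
  have hint : IntervalIntegrable (fun z => 2 * √(R ^ 2 - z ^ 2) / (z ^ 2 + k ^ 2))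
      volume (-R) R := by
    apply Continuous.intervalIntegrable
    exact Continuous.div (by fun_prop) (by fun_prop) fun z => by positivity
  refine ⟨hint, ?_⟩
  set s := √(R ^ 2 + k ^ 2) with hs
  have hs0 : 0 < s := Real.sqrt_pos.2 (by positivity)
  have hs2 : s ^ 2 = R ^ 2 + k ^ 2 := Real.sq_sqrt (by positivity)
  -- the arcsine form of this primitive is continuous up to the endpoints, unlike the arctangent form
  set G : ℝ → ℝ := fun z =>
    2 * (s / k * Real.arcsin (z * s / (R * √(z ^ 2 + k ^ 2))) - Real.arcsin (z / R)) with hG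
  have hne : ∀ z : ℝ, R * √(z ^ 2 + k ^ 2) ≠ 0 := fun z =>
    mul_ne_zero hR.ne' (Real.sqrt_pos.2 (by positivity)).ne'
  have hGc : Continuous G := by
    refine continuous_const.mul ((continuous_const.mul (Real.continuous_arcsin.comp ?_)).sub
      (Real.continuous_arcsin.comp (by fun_prop)))
    exact Continuous.div (by fun_prop) (by fun_prop) hne
  have hderiv : ∀ z ∈ Set.Ioo (-R) R,
      HasDerivAt G (2 * √(R ^ 2 - z ^ 2) / (z ^ 2 + k ^ 2)) z := by
    intro z hz
    have hzR : 0 < R ^ 2 - z ^ 2 := by nlinarith [hz.1, hz.2]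
    set m := √(R ^ 2 - z ^ 2) with hm
    have hm0 : 0 < m := Real.sqrt_pos.2 hzR
    have hm2 : m ^ 2 = R ^ 2 - z ^ 2 := Real.sq_sqrt hzR.le
    set q := √(z ^ 2 + k ^ 2) with hq
    have hq0 : 0 < q := Real.sqrt_pos.2 (by positivity)
    have hq2 : q ^ 2 = z ^ 2 + k ^ 2 := Real.sq_sqrt (by positivity)
    have d1 : HasDerivAt (fun z : ℝ => √(z ^ 2 + k ^ 2)) (z / q) z := by
      refine (((hasDerivAt_pow 2 z).add_const (k ^ 2)).sqrt (by positivity)).congr_deriv ?_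
      rw [← hq]; field_simp; ring
    have d2 : HasDerivAt (fun z : ℝ => z * s / (R * √(z ^ 2 + k ^ 2)))
        (s * k ^ 2 / (R * q ^ 3)) z := by
      refine (((hasDerivAt_id' z).mul_const s).fun_div (d1.const_mul R) (hne z)).congr_deriv ?_
      rw [← hq]
      field_simp
      rw [hq2]; ring
    have e1 : 1 - (z * s / (R * q)) ^ 2 = (k * m / (R * q)) ^ 2 := by
      field_simp
      rw [hm2, hq2, hs2]; ring
    have e2 : 1 - (z / R) ^ 2 = (m / R) ^ 2 := by
      field_simp
      rw [hm2]
    have n1 : z * s / (R * q) ≠ -1 ∧ z * s / (R * q) ≠ 1 := by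
      have : 0 < (k * m / (R * q)) ^ 2 := by positivity
      constructor <;> intro h <;> rw [h] at e1 <;> linarith
    have n2 : z / R ≠ -1 ∧ z / R ≠ 1 := by
      have : 0 < (m / R) ^ 2 := by positivity
      constructor <;> intro h <;> rw [h] at e2 <;> linarith
    have d3 := (Real.hasDerivAt_arcsin n1.1 n1.2).comp z d2
    have d4 := (Real.hasDerivAt_arcsin n2.1 n2.2).comp z ((hasDerivAt_id z).div_const R)
    refine (((d3.const_mul (s / k)).fun_sub d4).const_mul 2).congr_deriv ?_
    rw [e1, e2, Real.sqrt_sq (by positivity), Real.sqrt_sq (by positivity)]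
    rw [← hq2]
    field_simp
    rw [hm2, hs2, hq2]; ring
  rw [intervalIntegral.integral_eq_sub_of_hasDerivAt_of_le (by linarith) hGc.continuousOn hderiv
    hint]
  have hRs : √(R ^ 2 + k ^ 2) = s := rfl
  simp only [hG, neg_sq, hRs]
  rw [div_self hR.ne', neg_div, div_self hR.ne', mul_div_mul_right _ _ hs0.ne', div_self hR.ne',
    neg_mul, neg_div, mul_div_mul_right _ _ hs0.ne', div_self hR.ne', Real.arcsin_neg,
    Real.arcsin_one]
  ring

lemma volume_disc {x₀ k y₀ : ℝ} (hk : 0 < k) (hy : k ≤ y₀) :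
    volume (disc x₀ k y₀) = ENNReal.ofReal (2 * Real.pi * (y₀ / k - 1)) := by
  have hmeas : MeasurableSet {z : ℝ × ℝ | (z.1 - x₀) ^ 2 + z.2 ^ 2 + k ^ 2 ≤ 2 * y₀ * z.2} :=
    measurableSet_le (by fun_prop) (by fun_prop)
  have h := volume_eq_lintegral_fibers hmeas
  refine Eq.trans h ?_
  rcases hy.eq_or_lt with rfl | hy
  · -- the disc is a single point
    rw [div_self hk.ne', sub_self, mul_zero, ENNReal.ofReal_zero]
    refine (lintegral_congr fun x => ?_).trans lintegral_zero
    refine setLIntegral_measure_zero _ _ (Set.Subsingleton.measure_zero ?_ _)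
    rintro y ⟨-, hy⟩ y' ⟨-, hy'⟩
    have e : ∀ t : ℝ, (x - x₀) ^ 2 + t ^ 2 + k ^ 2 ≤ 2 * k * t → t = k := fun t ht => by
      have : (t - k) ^ 2 = 0 := by nlinarith [sq_nonneg (x - x₀), sq_nonneg (t - k)]
      linarith [pow_eq_zero_iff (two_ne_zero) |>.1 this]
    rw [e y hy, e y' hy']
  set R := √(y₀ ^ 2 - k ^ 2) with hRdef
  have hR0 : 0 < y₀ ^ 2 - k ^ 2 := by nlinarith
  have hR : 0 < R := Real.sqrt_pos.2 hR0
  have hR2 : R ^ 2 = y₀ ^ 2 - k ^ 2 := Real.sq_sqrt hR0.le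
  obtain ⟨hint, hval⟩ := integral_chord hR hk
  have hsq : √(R ^ 2 + k ^ 2) = y₀ := by
    rw [hR2, sub_add_cancel, Real.sqrt_sq (hk.trans hy).le]
  rw [hsq] at hval
  have hfib : ∀ x : ℝ, ∫⁻ y in {y | 0 < y ∧ (x, y) ∈
      {z : ℝ × ℝ | (z.1 - x₀) ^ 2 + z.2 ^ 2 + k ^ 2 ≤ 2 * y₀ * z.2}}, ENNReal.ofReal (1 / y ^ 2) =
      (Set.Icc (x₀ - R) (x₀ + R)).indicator (fun x => ENNReal.ofReal
        (2 * √(R ^ 2 - (x - x₀) ^ 2) / ((x - x₀) ^ 2 + k ^ 2))) x := by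
    intro x
    by_cases hx : x ∈ Set.Icc (x₀ - R) (x₀ + R)
    · rw [Set.indicator_of_mem hx]
      have hm : 0 ≤ R ^ 2 - (x - x₀) ^ 2 := by nlinarith [hx.1, hx.2]
      set m := √(R ^ 2 - (x - x₀) ^ 2)
      have hm2 : m ^ 2 = R ^ 2 - (x - x₀) ^ 2 := Real.sq_sqrt hm
      have hm0 : 0 ≤ m := Real.sqrt_nonneg _
      have hmy : m < y₀ := by
        have : m ^ 2 < y₀ ^ 2 := by nlinarith [sq_nonneg (x - x₀)]
        exact lt_of_pow_lt_pow_left₀ 2 (by linarith) this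
      have hset : {y | 0 < y ∧ (x, y) ∈
          {z : ℝ × ℝ | (z.1 - x₀) ^ 2 + z.2 ^ 2 + k ^ 2 ≤ 2 * y₀ * z.2}} =
          Set.Icc (y₀ - m) (y₀ + m) := by
        ext y
        simp only [Set.mem_ofPred_eq, Set.mem_Icc]
        constructor
        · rintro ⟨-, h⟩
          have : (y - y₀) ^ 2 ≤ m ^ 2 := by nlinarith
          have := abs_le.1 (abs_le_of_sq_le_sq this hm0)
          constructor <;> linarith [this.1, this.2]
        · rintro ⟨h1, h2⟩
          exact ⟨by linarith, by nlinarith⟩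
      rw [hset, lintegral_inv_sq_Icc (by linarith) (by linarith)]
      congr 1
      have e : (x - x₀) ^ 2 + k ^ 2 = (y₀ - m) * (y₀ + m) := by nlinarith
      have h1 : y₀ - m ≠ 0 := by linarith
      have h2 : y₀ + m ≠ 0 := by linarith
      rw [e]
      field_simp
      ring
    · rw [Set.indicator_of_notMem hx]
      convert setLIntegral_empty _
      ext y
      simp only [Set.mem_ofPred_eq, Set.mem_empty_iff_false, iff_false, not_and]
      intro _ h
      apply hx
      have : (x - x₀) ^ 2 ≤ R ^ 2 := by nlinarith [sq_nonneg (y - y₀)]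
      have := abs_le.1 (abs_le_of_sq_le_sq this hR.le)
      constructor <;> linarith [this.1, this.2]
  rw [lintegral_congr hfib, lintegral_indicator measurableSet_Icc, ← restrict_Ioc_eq_restrict_Icc]
  have hint' := hint.comp_sub_right x₀
  rw [neg_add_eq_sub, add_comm R] at hint'
  rw [← ofReal_integral_eq_lintegral_ofReal hint'.1
    (Filter.Eventually.of_forall fun y => by positivity),
    ← intervalIntegral.integral_of_le (by linarith), ← hval]
  congr 1
  have := intervalIntegral.integral_comp_sub_right (a := x₀ - R) (b := x₀ + R)
    (fun z => 2 * √(R ^ 2 - z ^ 2) / (z ^ 2 + k ^ 2)) x₀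
  rw [this]
  congr 1 <;> ring

lemma measurableSet_fdom : MeasurableSet fdom := by
  have h1 := UpperHalfPlane.continuous_re.measurable
  have h2 := UpperHalfPlane.continuous_im.measurable
  exact (measurableSet_le measurable_const h1).inter ((measurableSet_le h1 measurable_const).inter
    (measurableSet_le measurable_const ((h1.pow_const 2).add (h2.pow_const 2))))

lemma volume_fdom : volume fdom = ENNReal.ofReal (Real.pi / 6) := by
  have hmeas : MeasurableSet {z : ℝ × ℝ | -1 / 2 ≤ z.1 ∧ z.1 ≤ 0 ∧ 1 ≤ z.1 ^ 2 + z.2 ^ 2} := by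
    change MeasurableSet ({z : ℝ × ℝ | -1 / 2 ≤ z.1} ∩ ({z | z.1 ≤ 0} ∩ {z | 1 ≤ z.1 ^ 2 + z.2 ^ 2}))
    exact (measurableSet_le (by fun_prop) (by fun_prop)).inter ((measurableSet_le (by fun_prop)
      (by fun_prop)).inter (measurableSet_le (by fun_prop) (by fun_prop)))
  refine (volume_eq_lintegral_fibers hmeas).trans ?_
  have hfib : ∀ x : ℝ, ∫⁻ y in {y | 0 < y ∧ (x, y) ∈
      {z : ℝ × ℝ | -1 / 2 ≤ z.1 ∧ z.1 ≤ 0 ∧ 1 ≤ z.1 ^ 2 + z.2 ^ 2}}, ENNReal.ofReal (1 / y ^ 2) =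
      (Set.Icc (-1 / 2) 0).indicator (fun x => ENNReal.ofReal (1 / √(1 - x ^ 2))) x := by
    intro x
    by_cases hx : x ∈ Set.Icc (-1 / 2) (0 : ℝ)
    · rw [Set.indicator_of_mem hx]
      have hm : 0 < 1 - x ^ 2 := by nlinarith [hx.1, hx.2]
      rw [← lintegral_inv_sq_Ici (Real.sqrt_pos.2 hm)]
      congr 2
      ext y
      simp only [Set.mem_ofPred_eq, Set.mem_Ici]
      constructor
      · rintro ⟨h0, -, -, h⟩
        exact Real.sqrt_le_iff.2 ⟨h0.le, by linarith⟩
      · intro h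
        have h0 := (Real.sqrt_pos.2 hm).trans_le h
        exact ⟨h0, hx.1, hx.2, by linarith [(Real.sqrt_le_iff.1 h).2]⟩
    · rw [Set.indicator_of_notMem hx]
      convert setLIntegral_empty _
      ext y
      simp only [Set.mem_ofPred_eq, Set.mem_empty_iff_false, iff_false, not_and]
      exact fun _ h1 h2 => absurd ⟨h1, h2⟩ hx
  have hmem : ∀ x ∈ Set.uIcc (-1 / 2) (0 : ℝ), -1 / 2 ≤ x ∧ x ≤ 0 := by
    intro x hx
    rw [Set.uIcc_of_le (by norm_num)] at hx
    exact hx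
  have hint : IntervalIntegrable (fun x : ℝ => 1 / √(1 - x ^ 2)) volume (-1 / 2) 0 := by
    apply ContinuousOn.intervalIntegrable
    refine continuousOn_const.div (by fun_prop) fun x hx => (Real.sqrt_pos.2 ?_).ne'
    nlinarith [hmem x hx]
  rw [lintegral_congr hfib, lintegral_indicator measurableSet_Icc, ← restrict_Ioc_eq_restrict_Icc,
    ← ofReal_integral_eq_lintegral_ofReal hint.1
    (Filter.Eventually.of_forall fun y => by positivity),
    ← intervalIntegral.integral_of_le (by norm_num),
    intervalIntegral.integral_eq_sub_of_hasDerivAt (f := Real.arcsin) _ hint]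
  · have h1 : Real.arcsin (-1 / 2) = -(Real.pi / 6) := by
      rw [← Real.arcsin_sin (x := -(Real.pi / 6))]
      · rw [Real.sin_neg, Real.sin_pi_div_six]; norm_num
      · linarith [Real.pi_pos]
      · linarith [Real.pi_pos]
    rw [h1, Real.arcsin_zero]
    congr 1; ring
  · intro x hx
    have := hmem x hx
    exact Real.hasDerivAt_arcsin (by linarith) (by linarith)

lemma volume_fdom_inter_im_ge {c : ℝ} (hc : 1 ≤ c) :
    volume ({p : ℍ | c ≤ p.im} ∩ fdom) = ENNReal.ofReal (1 / 2 * (1 / c)) := by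
  have hmeas : MeasurableSet {z : ℝ × ℝ | -1 / 2 ≤ z.1 ∧ z.1 ≤ 0 ∧ c ≤ z.2} := by
    change MeasurableSet ({z : ℝ × ℝ | -1 / 2 ≤ z.1} ∩ ({z | z.1 ≤ 0} ∩ {z | c ≤ z.2}))
    exact (measurableSet_le (by fun_prop) (by fun_prop)).inter ((measurableSet_le (by fun_prop)
      (by fun_prop)).inter (measurableSet_le (by fun_prop) (by fun_prop)))
  have hset : {p : ℍ | c ≤ p.im} ∩ fdom =
      {p : ℍ | (p.re, p.im) ∈ {z : ℝ × ℝ | -1 / 2 ≤ z.1 ∧ z.1 ≤ 0 ∧ c ≤ z.2}} := by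
    ext p
    simp only [fdom, Set.mem_inter_iff, Set.mem_ofPred_eq]
    constructor
    · rintro ⟨h1, h2, h3, -⟩
      exact ⟨h2, h3, h1⟩
    · rintro ⟨h2, h3, h1⟩
      exact ⟨h1, h2, h3, by nlinarith [sq_nonneg p.re]⟩
  rw [hset, volume_eq_lintegral_fibers hmeas]
  have hfib : ∀ x : ℝ, ∫⁻ y in {y | 0 < y ∧ (x, y) ∈
      {z : ℝ × ℝ | -1 / 2 ≤ z.1 ∧ z.1 ≤ 0 ∧ c ≤ z.2}}, ENNReal.ofReal (1 / y ^ 2) =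
      (Set.Icc (-1 / 2) 0).indicator (fun _ => ENNReal.ofReal (1 / c)) x := by
    intro x
    by_cases hx : x ∈ Set.Icc (-1 / 2) (0 : ℝ)
    · rw [Set.indicator_of_mem hx, ← lintegral_inv_sq_Ici (by linarith)]
      congr 2
      ext y
      simp only [Set.mem_ofPred_eq, Set.mem_Ici]
      exact ⟨fun h => h.2.2.2, fun h => ⟨by linarith, hx.1, hx.2, h⟩⟩
    · rw [Set.indicator_of_notMem hx]
      convert setLIntegral_empty _
      ext y
      simp only [Set.mem_ofPred_eq, Set.mem_empty_iff_false, iff_false, not_and]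
      exact fun _ h1 h2 => absurd ⟨h1, h2⟩ hx
  rw [lintegral_congr hfib, lintegral_indicator measurableSet_Icc, setLIntegral_const,
    Real.volume_Icc, ← ENNReal.ofReal_mul (by positivity)]
  congr 1; ring

lemma volume_re_eq (c : ℝ) : volume {p : ℍ | p.re = c} = 0 := by
  have hmeas : MeasurableSet {z : ℝ × ℝ | z.1 = c} :=
    measurableSet_eq_fun (by fun_prop) (by fun_prop)
  refine (volume_eq_lintegral_fibers hmeas).trans ?_
  rw [lintegral_eq_zero_iff' ?_]
  · have : ∀ᵐ x : ℝ, x ≠ c := by simp [ae_iff]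
    filter_upwards [this] with x hx
    simp [hx]
  · have : (fun x : ℝ => ∫⁻ y in {y | 0 < y ∧ (x, y) ∈ {z : ℝ × ℝ | z.1 = c}},
        ENNReal.ofReal (1 / y ^ 2)) = Set.indicator {c} fun _ =>
          ∫⁻ y in {y : ℝ | 0 < y}, ENNReal.ofReal (1 / y ^ 2) := by
      ext x
      by_cases hx : x = c
      · simp [hx]
      · simp [hx]
    rw [this]
    exact (measurable_const.indicator (measurableSet_singleton c)).aemeasurable

/-! ### Reflections and sectors of discs -/

/-- The reflection `p ↦ -1 - p̄` in the line `x = -1/2`. -/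
def reflLine : GL (Fin 2) ℝ := .mkOfDetNeZero !![-1, -1; 0, 1] (by simp)

/-- The inversion `p ↦ 1 / p̄` in the unit circle. -/
def reflCircle : GL (Fin 2) ℝ := .mkOfDetNeZero !![0, 1; 1, 0] (by simp)

lemma reflLine_smul (p : ℍ) : (reflLine • p).re = -1 - p.re ∧ (reflLine • p).im = p.im := by
  have hσ : UpperHalfPlane.σ reflLine = Complex.conjCAE := by
    simp [UpperHalfPlane.σ, reflLine]
  have h : ((reflLine • p : ℍ) : ℂ) = (starRingEnd ℂ) (-p - 1) := by
    rw [UpperHalfPlane.coe_smul, hσ]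
    simp [UpperHalfPlane.num, UpperHalfPlane.denom, reflLine]
    ring
  constructor
  · rw [← UpperHalfPlane.coe_re, h]; simp; ring
  · rw [← UpperHalfPlane.coe_im, h]; simp

lemma reflCircle_smul (p : ℍ) : (reflCircle • p).re = p.re / (p.re ^ 2 + p.im ^ 2) ∧
    (reflCircle • p).im = p.im / (p.re ^ 2 + p.im ^ 2) := by
  have hσ : UpperHalfPlane.σ reflCircle = Complex.conjCAE := by
    simp [UpperHalfPlane.σ, reflCircle]
  have h : ((reflCircle • p : ℍ) : ℂ) = (starRingEnd ℂ) (1 / p) := by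
    rw [UpperHalfPlane.coe_smul, hσ]
    simp [UpperHalfPlane.num, UpperHalfPlane.denom, reflCircle]
  constructor
  · rw [← UpperHalfPlane.coe_re, h]; simp [Complex.normSq_apply, sq]
  · rw [← UpperHalfPlane.coe_im, h]; simp [Complex.normSq_apply, sq]

/-- The square `|p| ^ 2` of the absolute value. -/
def absSq (p : ℍ) : ℝ := p.re ^ 2 + p.im ^ 2

lemma absSq_pos (p : ℍ) : 0 < absSq p := by
  have := p.im_pos
  unfold absSq
  positivity

lemma measurable_absSq : Measurable absSq :=
  ((UpperHalfPlane.continuous_re.measurable.pow_const 2).add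
    (UpperHalfPlane.continuous_im.measurable.pow_const 2))

/-- The square `|p + 1| ^ 2` of the distance to `-1`. -/
def absSqShift (p : ℍ) : ℝ := absSq p + 2 * p.re + 1

lemma measurable_absSqShift : Measurable absSqShift :=
  (measurable_absSq.add (UpperHalfPlane.continuous_re.measurable.const_mul 2)).add_const 1

lemma absSq_reflLine (p : ℍ) : absSq (reflLine • p) = absSqShift p := by
  unfold absSqShift absSq
  rw [(reflLine_smul p).1, (reflLine_smul p).2]
  ring

lemma absSqShift_reflLine (p : ℍ) : absSqShift (reflLine • p) = absSq p := by
  unfold absSqShift absSq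
  rw [(reflLine_smul p).1, (reflLine_smul p).2]
  ring

lemma absSq_reflCircle (p : ℍ) : absSq (reflCircle • p) = 1 / absSq p := by
  have := (absSq_pos p).ne'
  unfold absSq at *
  rw [(reflCircle_smul p).1, (reflCircle_smul p).2]
  field_simp

lemma absSqShift_reflCircle (p : ℍ) : absSqShift (reflCircle • p) = absSqShift p / absSq p := by
  have := (absSq_pos p).ne'
  rw [absSqShift, absSq_reflCircle, (reflCircle_smul p).1]
  change 1 / absSq p + 2 * (p.re / absSq p) + 1 = _
  unfold absSqShift
  field_simp
  ring

lemma volume_absSqShift_eq_one : volume {p : ℍ | absSqShift p = 1} = 0 := by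
  rw [← measure_preimage_smul volume reflCircle {p : ℍ | absSqShift p = 1}]
  convert volume_re_eq (-1 / 2) using 2
  ext p
  have := (absSq_pos p).ne'
  simp only [Set.mem_preimage, Set.mem_ofPred_eq, absSqShift_reflCircle, div_eq_one_iff_eq this]
  unfold absSqShift
  constructor <;> intro h <;> linarith

lemma volume_absSq_eq_one : volume {p : ℍ | absSq p = 1} = 0 := by
  rw [← measure_preimage_smul volume reflLine {p : ℍ | absSq p = 1}]
  simpa only [Set.preimage_ofPred_eq, absSq_reflLine] using volume_absSqShift_eq_one

/-- A null set of ties cuts every set into two parts. -/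
lemma measure_inter_le_add_inter_ge {α : Type*} [MeasurableSpace α] {μ : Measure α} {f g : α → ℝ}
    (hf : Measurable f) (hg : Measurable g) (h0 : μ {p | f p = g p} = 0) {S : Set α} :
    μ (S ∩ {p | f p ≤ g p}) + μ (S ∩ {p | g p ≤ f p}) = μ S := by
  rw [← measure_inter_add_sdiff S (measurableSet_le hf hg)]
  congr 1
  apply measure_congr
  have h1 : ∀ᵐ p ∂μ, f p ≠ g p := measure_eq_zero_iff_ae_notMem.1 h0
  filter_upwards [h1] with p hp
  apply propext
  change (p ∈ S ∧ g p ≤ f p) ↔ (p ∈ S ∧ ¬ f p ≤ g p)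
  rw [not_le]
  exact and_congr_right fun _ => ⟨fun h => lt_of_le_of_ne h hp.symm, le_of_lt⟩

lemma reflCircle_smul_mem_disc {x₀ k y₀ : ℝ} (h : x₀ ^ 2 + k ^ 2 = 1) (p : ℍ) :
    reflCircle • p ∈ disc x₀ k y₀ ↔ p ∈ disc x₀ k y₀ := by
  have hP := absSq_pos p
  simp only [disc, Set.mem_ofPred_eq]
  rw [(reflCircle_smul p).1, (reflCircle_smul p).2]
  unfold absSq at hP
  rw [← mul_le_mul_iff_of_pos_right hP]
  have e1 : ((p.re / (p.re ^ 2 + p.im ^ 2) - x₀) ^ 2 + (p.im / (p.re ^ 2 + p.im ^ 2)) ^ 2 + k ^ 2) *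
      (p.re ^ 2 + p.im ^ 2) = 1 - 2 * x₀ * p.re + (x₀ ^ 2 + k ^ 2) * (p.re ^ 2 + p.im ^ 2) := by
    field_simp
    ring
  have e2 : 2 * y₀ * (p.im / (p.re ^ 2 + p.im ^ 2)) * (p.re ^ 2 + p.im ^ 2) = 2 * y₀ * p.im := by
    field_simp
  rw [e1, e2, h]
  constructor <;> intro h <;> nlinarith

lemma reflLine_smul_mem_disc {k y₀ : ℝ} (p : ℍ) :
    reflLine • p ∈ disc (-1 / 2) k y₀ ↔ p ∈ disc (-1 / 2) k y₀ := by
  simp only [disc, Set.mem_ofPred_eq]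
  rw [(reflLine_smul p).1, (reflLine_smul p).2, show (-1 - p.re - -1 / 2) = -(p.re - -1 / 2) by ring,
    neg_sq]

/-- The unit circle halves the discs that are orthogonal to it. -/
lemma volume_disc_inter_half {x₀ k y₀ : ℝ} (h : x₀ ^ 2 + k ^ 2 = 1) :
    2 * volume (disc x₀ k y₀ ∩ {p | 1 ≤ absSq p}) = volume (disc x₀ k y₀) := by
  rw [← measure_inter_le_add_inter_ge measurable_absSq (measurable_const (a := (1 : ℝ)))
    volume_absSq_eq_one (S := disc x₀ k y₀), two_mul]
  congr 1
  rw [← measure_preimage_smul volume reflCircle]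
  congr 1
  ext p
  simp only [Set.mem_preimage, Set.mem_inter_iff, reflCircle_smul_mem_disc h, Set.mem_ofPred_eq,
    absSq_reflCircle, one_le_div (absSq_pos p)]

/-- For discs centred at the corner `-1/2 + i √3/2`, the six orderings of `1`, `|p| ^ 2` and
`|p + 1| ^ 2` describe sectors of equal area: the two reflections permute these numbers, up to a
common factor. -/
lemma volume_disc_inter_sixth {k y₀ : ℝ} (hk : k ^ 2 = 3 / 4) :
    6 * volume (disc (-1 / 2) k y₀ ∩ {p | absSq p ≤ absSqShift p} ∩ {p | 1 ≤ absSq p}) =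
      volume (disc (-1 / 2) k y₀) := by
  have h : (-1 / 2 : ℝ) ^ 2 + k ^ 2 = 1 := by rw [hk]; norm_num
  set E := disc (-1 / 2) k y₀
  have hE1 : ∀ p : ℍ, reflCircle • p ∈ E ↔ p ∈ E := reflCircle_smul_mem_disc h
  have hE2 : ∀ p : ℍ, reflLine • p ∈ E ↔ p ∈ E := reflLine_smul_mem_disc
  have n2 : volume {p : ℍ | absSq p = absSqShift p} = 0 := by
    convert volume_re_eq (-1 / 2) using 2
    ext p
    simp only [absSqShift, Set.mem_ofPred_eq]
    constructor <;> intro h <;> linarith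
  have c1 : Measurable fun _ : ℍ => (1 : ℝ) := measurable_const
  -- `E` is halved by the vertical line
  have s1 := measure_inter_le_add_inter_ge measurable_absSq measurable_absSqShift n2 (S := E)
  have t1 : volume (E ∩ {p | absSqShift p ≤ absSq p}) =
      volume (E ∩ {p | absSq p ≤ absSqShift p}) := by
    rw [← measure_preimage_smul volume reflLine]
    congr 1
    ext p
    simp only [Set.mem_preimage, Set.mem_inter_iff, hE2, Set.mem_ofPred_eq, absSq_reflLine,
      absSqShift_reflLine]
  -- the half is cut into three sectors
  have s2 := measure_inter_le_add_inter_ge measurable_absSq c1 volume_absSq_eq_one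
    (S := E ∩ {p | absSq p ≤ absSqShift p})
  have s3 := measure_inter_le_add_inter_ge measurable_absSqShift c1 volume_absSqShift_eq_one
    (S := E ∩ {p | absSq p ≤ absSqShift p} ∩ {p | absSq p ≤ 1})
  set T := E ∩ {p | absSq p ≤ absSqShift p} ∩ {p | 1 ≤ absSq p} with hT
  have t2 : volume (E ∩ {p | absSq p ≤ absSqShift p} ∩ {p | absSq p ≤ 1} ∩
      {p | 1 ≤ absSqShift p}) = volume T := by
    rw [← measure_preimage_smul volume reflCircle T]
    congr 1
    ext p
    have hp := absSq_pos p
    simp only [hT, Set.mem_preimage, Set.mem_inter_iff, hE1, Set.mem_ofPred_eq, absSq_reflCircle,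
      absSqShift_reflCircle, one_le_div hp, div_le_div_iff_of_pos_right hp]
    constructor
    · rintro ⟨⟨⟨h1, h2⟩, h3⟩, h4⟩
      exact ⟨⟨h1, h4⟩, h3⟩
    · rintro ⟨⟨h1, h4⟩, h3⟩
      exact ⟨⟨⟨h1, h3.trans h4⟩, h3⟩, h4⟩
  have t3 : volume (E ∩ {p | absSq p ≤ absSqShift p} ∩ {p | absSq p ≤ 1} ∩
      {p | absSqShift p ≤ 1}) = volume T := by
    rw [← measure_preimage_smul volume reflLine T, ← measure_preimage_smul volume reflCircle
      ((fun p => reflLine • p) ⁻¹' T)]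
    congr 1
    ext p
    have hp := absSq_pos p
    simp only [hT, Set.mem_preimage, Set.mem_inter_iff, hE1, hE2, Set.mem_ofPred_eq,
      absSq_reflLine, absSqShift_reflLine, absSq_reflCircle, absSqShift_reflCircle, one_le_div hp,
      div_le_div_iff_of_pos_right hp]
    constructor
    · rintro ⟨⟨⟨h1, h2⟩, h3⟩, h4⟩
      exact ⟨⟨h1, h4⟩, h2⟩
    · rintro ⟨⟨h1, h4⟩, h3⟩
      exact ⟨⟨⟨h1, h3⟩, h3.trans h4⟩, h4⟩
  rw [← s1, t1, ← s2, ← s3, t2, t3]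
  ring

/-! ### Depth discs in the half-plane -/

lemma measurable_depthFun (r : Fin 4 → ℤ) : Measurable (depthFun r) := by
  have h1 := UpperHalfPlane.continuous_re.measurable
  have h2 := UpperHalfPlane.continuous_im.measurable
  unfold depthFun
  exact measurable_const.sub (((measurable_const.add (h1.const_mul _)).add
    (((h1.pow_const 2).add (h2.pow_const 2)).const_mul _)).div h2)

/-- The norm of a row in the coefficients `t, u, v, w`: `t ^ 2 - 1 = 4 u w - 4 v ^ 2`. -/
lemma sub_one_div_four_form {r : Fin 4 → ℤ} (hform : 2 * ∑ l, r l ^ 2 - (∑ l, r l) ^ 2 = 1) :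
    (r 1 + r 2 + r 3 - r 0) ^ 2 - 1 = 4 * (r 1 + r 3) * (r 2 + r 3) - 4 * r 3 ^ 2 := by
  simp only [Fin.sum_univ_four] at hform
  linear_combination hform

lemma le_depthFun_iff (r : Fin 4 → ℤ) (s : ℝ) (p : ℍ) :
    s ≤ depthFun r p ↔ (r 1 + r 3) + 2 * r 3 * p.re + (r 2 + r 3) * absSq p ≤
      ((r 1 + r 2 + r 3 - r 0) - s) * p.im := by
  rw [← div_le_iff₀ p.im_pos, depthFun]
  push_cast
  unfold absSq
  constructor <;> intro h <;> linarith

/-- The superlevel sets of `depthFun` are concentric hyperbolic discs. -/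
lemma setOf_le_depthFun {r : Fin 4 → ℤ} (hform : 2 * ∑ l, r l ^ 2 - (∑ l, r l) ^ 2 = 1)
    (hw : 0 < r 2 + r 3) {κ : ℝ} (hκ : κ ^ 2 = (r 1 + r 2 + r 3 - r 0 : ℝ) ^ 2 - 1) (s : ℝ) :
    {p | s ≤ depthFun r p} = disc (-r 3 / (r 2 + r 3)) (κ / (2 * (r 2 + r 3)))
      (((r 1 + r 2 + r 3 - r 0) - s) / (2 * (r 2 + r 3))) := by
  have hq : (r 1 + r 2 + r 3 - r 0 : ℝ) ^ 2 - 1 =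
      4 * (r 1 + r 3) * (r 2 + r 3) - 4 * r 3 ^ 2 := by
    exact_mod_cast sub_one_div_four_form hform
  have hw' : (0 : ℝ) < r 2 + r 3 := by exact_mod_cast hw
  ext p
  simp only [disc, Set.mem_ofPred_eq]
  rw [le_depthFun_iff, ← mul_le_mul_iff_of_pos_left hw']
  generalize hW : (r 2 + r 3 : ℝ) = w at *
  rw [← mul_le_mul_iff_of_pos_left hw']
  have e1 : w * (w * ((p.re - -r 3 / w) ^ 2 + p.im ^ 2 + (κ / (2 * w)) ^ 2)) =
      w * ((r 1 + r 3) + 2 * r 3 * p.re + w * absSq p) := by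
    have : κ ^ 2 = 4 * (r 1 + r 3) * w - 4 * r 3 ^ 2 := hκ.trans hq
    unfold absSq
    field_simp
    rw [this]
    ring
  have e2 : w * (w * (2 * (((r 1 + r 2 + r 3 - r 0) - s) / (2 * w)) * p.im)) =
      w * (((r 1 + r 2 + r 3 - r 0) - s) * p.im) := by
    field_simp
  rw [← e1, ← e2, mul_le_mul_iff_of_pos_left hw', mul_le_mul_iff_of_pos_left hw',
    mul_le_mul_iff_of_pos_left hw']

/-- The disc `0 ≤ depthFun r` has Euclidean radius `1 / (2 w)` and its centre has real part
`-r₃ / w`. -/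
lemma re_bounds {r : Fin 4 → ℤ} (hform : 2 * ∑ l, r l ^ 2 - (∑ l, r l) ^ 2 = 1)
    (hw : 0 < r 2 + r 3) {p : ℍ} (h : 0 ≤ depthFun r p) :
    -1 ≤ 2 * (r 2 + r 3) * p.re + 2 * r 3 ∧ 2 * (r 2 + r 3) * p.re + 2 * r 3 ≤ 1 := by
  have hq : (r 1 + r 2 + r 3 - r 0 : ℝ) ^ 2 - 1 =
      4 * (r 1 + r 3) * (r 2 + r 3) - 4 * r 3 ^ 2 := by
    exact_mod_cast sub_one_div_four_form hform
  have hw' : (0 : ℝ) < r 2 + r 3 := by exact_mod_cast hw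
  have h1 := (le_depthFun_iff r 0 p).1 h
  rw [sub_zero, ← mul_le_mul_iff_of_pos_left hw'] at h1
  unfold absSq at h1
  refine abs_le.1 (abs_le_of_sq_le_sq ?_ zero_le_one)
  nlinarith [sq_nonneg (2 * (r 2 + r 3) * p.im - (r 1 + r 2 + r 3 - r 0 : ℝ))]

/-- A disc that meets the fundamental domain in positive area is not on the outer side of any of the
three sides: by integrality it could at most touch such a side. -/
lemma ineqs_of_volume_ne_zero {r : Fin 4 → ℤ} (hform : 2 * ∑ l, r l ^ 2 - (∑ l, r l) ^ 2 = 1)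
    (hw : 0 < r 2 + r 3) (hvol : volume ({p | 0 ≤ depthFun r p} ∩ fdom) ≠ 0) :
    r 2 ≤ r 1 ∧ r 3 ≤ r 2 ∧ 0 ≤ r 3 := by
  have hq : (r 1 + r 2 + r 3 - r 0 : ℝ) ^ 2 - 1 =
      4 * (r 1 + r 3) * (r 2 + r 3) - 4 * r 3 ^ 2 := by
    exact_mod_cast sub_one_div_four_form hform
  have hw' : (1 : ℝ) ≤ r 2 + r 3 := by exact_mod_cast hw
  refine ⟨?_, ?_, ?_⟩
  · by_contra hcon
    have hcon' : (r 1 + 1 : ℝ) ≤ r 2 := by exact_mod_cast not_le.1 hcon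
    refine hvol (measure_mono_null ?_ volume_absSq_eq_one)
    rintro p ⟨h0, -, -, hP⟩
    have h1 := (le_depthFun_iff r 0 p).1 h0
    change 1 ≤ absSq p at hP
    rw [sub_zero] at h1
    change absSq p = 1
    -- Cauchy-Schwarz for `(x, y)` and `(-2 r₃, t)`
    have hcs : (((r 1 + r 2 + r 3 - r 0 : ℝ)) * p.im - 2 * r 3 * p.re) ^ 2 ≤
        (4 * (r 1 + r 3) * (r 2 + r 3) + 1) * absSq p := by
      unfold absSq
      nlinarith [sq_nonneg (((r 1 + r 2 + r 3 - r 0 : ℝ)) * p.re + 2 * r 3 * p.im)]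
    have hu : (-1 : ℝ) ≤ 4 * (r 1 + r 3) * (r 2 + r 3) := by
      nlinarith [sq_nonneg (r 1 + r 2 + r 3 - r 0 : ℝ), sq_nonneg (r 3 : ℝ)]
    have huw : (r 1 + r 3 : ℝ) ≤ r 2 + r 3 - 1 := by linarith
    generalize (r 2 + r 3 : ℝ) = w at *
    generalize (r 1 + r 3 : ℝ) = u at *
    generalize absSq p = P at *
    have hwu : -w ≤ u := by
      by_contra hlt
      nlinarith
    have hnn : 0 ≤ u + w * P := by nlinarith
    have h2 : (u + w * P) ^ 2 ≤ (4 * u * w + 1) * P :=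
      (pow_le_pow_left₀ hnn (by linarith) 2).trans hcs
    have h3 : (w * P - u) ^ 2 ≤ P := by nlinarith
    have h4 : 0 ≤ w * (P - 1) := mul_nonneg (by linarith) (by linarith)
    have h5 : (w * (P - 1) + 1) ^ 2 ≤ P :=
      (pow_le_pow_left₀ (by linarith) (by linarith) 2).trans h3
    nlinarith [sq_nonneg (w * (P - 1))]
  · by_contra hcon
    have hcon' : (r 2 + 1 : ℝ) ≤ r 3 := by exact_mod_cast not_le.1 hcon
    refine hvol (measure_mono_null ?_ (volume_re_eq (-1 / 2)))
    rintro p ⟨h0, hx, -, -⟩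
    obtain ⟨-, h1⟩ := re_bounds hform hw h0
    change p.re = -1 / 2
    nlinarith
  · by_contra hcon
    have hcon' : (r 3 + 1 : ℝ) ≤ 0 := by exact_mod_cast not_le.1 hcon
    refine hvol (measure_mono_null ?_ measure_empty)
    rintro p ⟨h0, -, hx, -⟩
    obtain ⟨h1, -⟩ := re_bounds hform hw h0
    nlinarith

/-- If the areas of the superlevel sets of `h` decrease linearly on `[0, T]` down to `0`, then `h` is
uniformly distributed on `[0, T]`. -/
lemma uniform_of_volume_eq {F : Set ℍ} (hF : MeasurableSet F) {h H : ℍ → ℝ} (hh : Measurable h)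
    {c T : ℝ} (hc : 0 < c) (hT : 0 < T)
    (hvol : ∀ s ∈ Set.Icc 0 T, volume ({p | s ≤ h p} ∩ F) = ENNReal.ofReal (c * (T - s)))
    (hH : ∀ p, 0 ≤ h p → H p = h p) :
    pdf.IsUniform H (Set.Icc 0 T) (cond (volume : Measure ℍ) ({p | 0 ≤ h p} ∩ F)) volume := by
  set R := {p | 0 ≤ h p} ∩ F with hR
  have hRm : MeasurableSet R := (measurableSet_le measurable_const hh).inter hF
  have hRvol : volume R = ENNReal.ofReal (c * T) := by
    rw [hR, hvol 0 ⟨le_rfl, hT.le⟩, sub_zero]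
  have hR0 : volume R ≠ 0 := by
    rw [hRvol]; simp only [ne_eq, ENNReal.ofReal_eq_zero, not_le]; positivity
  have hRt : volume R ≠ ⊤ := by rw [hRvol]; exact ENNReal.ofReal_ne_top
  have hvol' : ∀ s, 0 ≤ s → volume ({p | s ≤ h p} ∩ F) = ENNReal.ofReal (c * (T - s)) := by
    intro s hs
    rcases le_total s T with hsT | hsT
    · exact hvol s ⟨hs, hsT⟩
    · rw [ENNReal.ofReal_of_nonpos (mul_nonpos_of_nonneg_of_nonpos hc.le (by linarith))]
      have h0 : volume ({p | T ≤ h p} ∩ F) = 0 := by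
        rw [hvol T ⟨hT.le, le_rfl⟩, sub_self, mul_zero, ENNReal.ofReal_zero]
      exact measure_mono_null
        (Set.inter_subset_inter_left F fun p (hp : s ≤ h p) => hsT.trans hp) h0
  have hae : H =ᵐ[cond volume R] h :=
    ae_cond_of_forall_mem hRm fun p hp => hH p hp.1
  have : IsProbabilityMeasure (cond (volume : Measure ℍ) R) := cond_isProbabilityMeasure_of_finite hR0 hRt
  rw [pdf.IsUniform, Measure.map_congr hae]
  have := Measure.isProbabilityMeasure_map (μ := cond (volume : Measure ℍ) R) hh.aemeasurable
  refine Measure.ext_of_Ici _ _ fun a => ?_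
  rw [Measure.map_apply hh measurableSet_Ici, cond_apply hRm, cond_apply measurableSet_Icc]
  have e1 : R ∩ h ⁻¹' Set.Ici a = {p | max 0 a ≤ h p} ∩ F := by
    ext p
    simp only [hR, Set.mem_inter_iff, Set.mem_preimage, Set.mem_Ici, Set.mem_ofPred_eq, max_le_iff]
    tauto
  have e2 : Set.Icc 0 T ∩ Set.Ici a = Set.Icc (max 0 a) T := by
    ext x
    simp only [Set.mem_inter_iff, Set.mem_Icc, Set.mem_Ici, max_le_iff]
    tauto
  rw [e1, e2, hvol' _ (le_max_left _ _), hRvol, Real.volume_Icc, Real.volume_Icc, sub_zero,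
    ENNReal.ofReal_mul hc.le, ENNReal.ofReal_mul hc.le, ENNReal.mul_inv (by simp [hc]) (by simp),
    mul_mul_mul_comm, ENNReal.inv_mul_cancel (by simpa using hc) (by simp), one_mul]

/-! ### Depth regions and their areas -/

lemma eq_ofReal_div {m : ℕ} (hm : 0 < m) {x : ENNReal} {A : ℝ}
    (h : (m : ENNReal) * x = ENNReal.ofReal A) : x = ENNReal.ofReal (A / m) := by
  have hm' : (0 : ℝ) < m := by exact_mod_cast hm
  rw [ENNReal.ofReal_div_of_pos hm', ENNReal.ofReal_natCast, ← h, mul_comm,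
    ENNReal.mul_div_cancel_right (by exact_mod_cast hm.ne') (ENNReal.natCast_ne_top m)]

/-- If `u > w`, the depth disc lies outside the unit circle. -/
lemma one_le_absSq_of_depthFun {r : Fin 4 → ℤ} (hform : 2 * ∑ l, r l ^ 2 - (∑ l, r l) ^ 2 = 1)
    (hw : 0 < r 2 + r 3) (h12 : r 2 < r 1) {p : ℍ} (h : 0 ≤ depthFun r p) : 1 ≤ absSq p := by
  have hq : (r 1 + r 2 + r 3 - r 0 : ℝ) ^ 2 - 1 =
      4 * (r 1 + r 3) * (r 2 + r 3) - 4 * r 3 ^ 2 := by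
    exact_mod_cast sub_one_div_four_form hform
  have hw' : (1 : ℝ) ≤ r 2 + r 3 := by exact_mod_cast hw
  have h12' : (r 2 + 1 : ℝ) ≤ r 1 := by exact_mod_cast h12
  have h1 := (le_depthFun_iff r 0 p).1 h
  rw [sub_zero] at h1
  -- Cauchy-Schwarz for `(x, y)` and `(-2 r₃, t)`
  have hcs : (((r 1 + r 2 + r 3 - r 0 : ℝ)) * p.im - 2 * r 3 * p.re) ^ 2 ≤
      (4 * (r 1 + r 3) * (r 2 + r 3) + 1) * absSq p := by
    unfold absSq
    nlinarith [sq_nonneg (((r 1 + r 2 + r 3 - r 0 : ℝ)) * p.re + 2 * r 3 * p.im)]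
  have huw : (r 2 + r 3 + 1 : ℝ) ≤ r 1 + r 3 := by linarith
  have hP := absSq_pos p
  generalize (r 2 + r 3 : ℝ) = w at *
  generalize (r 1 + r 3 : ℝ) = u at *
  generalize absSq p = P at *
  by_contra hlt
  have hwP : 0 < w * P := by positivity
  have h2 : (u + w * P) ^ 2 ≤ (4 * u * w + 1) * P :=
    (pow_le_pow_left₀ (by linarith) (by linarith) 2).trans hcs
  have h3 : (u - w * P) ^ 2 ≤ P := by nlinarith
  have h4 : 1 ≤ u - w * P := by nlinarith
  nlinarith

/-- The superlevel sets of the height of a word within the fundamental domain.  The factor is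
`a_W / 12` of the area of the whole disc. -/
lemma volume_depth_of_word (W : DepthElement) (hne : W.toWord ≠ [])
    (hvol : volume ({p | 0 ≤ depthFun (wordMat W.toWord W.pos) p} ∩ fdom) ≠ 0) :
    1 < W.t ∧ 0 < aCoeff W ∧ ∀ s ∈ Set.Icc 0 (W.t - √(W.t ^ 2 - 1)),
      volume ({p | s ≤ depthFun (wordMat W.toWord W.pos) p} ∩ fdom) =
        ENNReal.ofReal (aCoeff W * (Real.pi / 6) / √(W.t ^ 2 - 1) *
          (W.t - √(W.t ^ 2 - 1) - s)) := by
  have hred : IsReduced W.toWord := by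
    cases W with
    | ident j => exact absurd rfl hne
    | word w _ h => exact h
  have hhead : W.toWord.head? = some W.pos := by
    cases W with
    | ident j => exact absurd rfl hne
    | word w h _ => exact List.head?_eq_some_head h
  have ht := t_eq W
  have hform := row_form_eq_one W.toWord W.pos
  have hpos : ∀ m, 1 ≤ pairing (wordMat W.toWord W.pos) m := by
    obtain ⟨v, l, hvl⟩ : ∃ v l, W.toWord = v ++ [l] :=
      ⟨_, _, (List.dropLast_append_getLast hne).symm⟩
    rw [hvl] at hred hhead ⊢
    exact (pairing_of_head v l _ hred hhead).1
  have hclass := row_classification hred hhead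
  have hletters : (∀ a ∈ W.toWord, a = 0 ∨ a = 3) →
      wordMat W.toWord W.pos 1 = wordMat W.toWord W.pos 2 := fun h =>
    row_one_eq_two_of_letters h (h _ (List.mem_of_mem_head? hhead))
  have hzero : W.toWord = [0] → wordMat W.toWord W.pos = ![-1, 2, 2, 2] := by
    intro h
    have hp : W.pos = 0 := by simpa [h] using hhead.symm
    rw [h, hp]
    decide
  generalize wordMat W.toWord W.pos = r at *
  have hw : 0 < r 2 + r 3 := by
    have h0 := hpos 0
    have h1 := hpos 1
    simp only [pairing, Fin.sum_univ_four] at h0 h1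
    linarith
  obtain ⟨h12, h23, h3⟩ := ineqs_of_volume_ne_zero hform hw hvol
  obtain ⟨h3', hsingle, hchain⟩ := hclass h12 h23 h3
  have hq : (r 1 + r 2 + r 3 - r 0 : ℝ) ^ 2 - 1 =
      4 * (r 1 + r 3) * (r 2 + r 3) - 4 * r 3 ^ 2 := by
    exact_mod_cast sub_one_div_four_form hform
  push_cast at ht
  have ht1 : 1 < W.t := by
    have h0 : 1 ≤ r 1 + r 2 + r 3 - r 0 := by
      have := hpos 0
      simp only [pairing, Fin.sum_univ_four] at this
      linarith
    have h0' : (1 : ℝ) ≤ W.t := by rw [ht]; exact_mod_cast h0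
    have a1 : (r 2 : ℝ) ≤ r 1 := by exact_mod_cast h12
    have a2 : (r 3 : ℝ) ≤ r 2 := by exact_mod_cast h23
    have a3 : (1 : ℝ) ≤ r 3 := by exact_mod_cast h3'
    rw [← ht] at hq
    by_contra hcon
    nlinarith
  have hκ0 : 0 < W.t ^ 2 - 1 := by nlinarith
  have hκ : √(W.t ^ 2 - 1) ^ 2 = (r 1 + r 2 + r 3 - r 0 : ℝ) ^ 2 - 1 := by
    rw [Real.sq_sqrt hκ0.le, ht]
  have hκpos := Real.sqrt_pos.2 hκ0
  generalize √(W.t ^ 2 - 1) = κ at *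
  have hw' : (0 : ℝ) < r 2 + r 3 := by exact_mod_cast hw
  have hdisc := setOf_le_depthFun hform hw hκ
  have hball : ∀ s ∈ Set.Icc 0 (W.t - κ), volume {p | s ≤ depthFun r p} =
      ENNReal.ofReal (12 * (Real.pi / 6) / κ * (W.t - κ - s)) := by
    intro s hs
    rw [hdisc, volume_disc (by positivity)]
    · rw [← ht]
      congr 1
      field_simp
      ring
    · rw [← ht]
      gcongr
      linarith [hs.2]
  have hmono : ∀ {s : ℝ} {p : ℍ}, 0 ≤ s → s ≤ depthFun r p → 0 ≤ depthFun r p :=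
    fun h h' => h.trans h'
  have hre : ∀ p, 0 ≤ depthFun r p → p.re ≤ 0 := by
    intro p hp
    have h1 := (re_bounds hform hw hp).2
    have a3 : (1 : ℝ) ≤ r 3 := by exact_mod_cast h3'
    by_contra hcon
    have : 0 < (r 2 + r 3 : ℝ) * p.re := mul_pos hw' (not_le.1 hcon)
    linarith
  -- by `hball` it suffices that the domain contains the fraction `1 / m = a_W / 12` of each disc
  suffices hfrac : ∃ m : ℕ, 0 < m ∧ aCoeff W = 12 / m ∧ ∀ s, 0 ≤ s →
      m * volume ({p | s ≤ depthFun r p} ∩ fdom) = volume {p | s ≤ depthFun r p} by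
    obtain ⟨m, hm, ha, hfr⟩ := hfrac
    have hm' : (0 : ℝ) < m := by exact_mod_cast hm
    refine ⟨ht1, by rw [ha]; positivity, fun s hs => ?_⟩
    rw [eq_ofReal_div hm ((hfr s hs.1).trans (hball s hs)), ha]
    congr 1
    field_simp
  rcases h23.eq_or_lt with h23 | h23
  · have hw0 := hsingle h23.symm
    have hr := hzero hw0
    refine ⟨6, by norm_num, ?_, fun s hs => ?_⟩
    · rw [aCoeff, if_pos hw0]; norm_num
    · have hc : (-r 3 / (r 2 + r 3) : ℝ) = -1 / 2 := by simp [hr]; norm_num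
      have hk : (κ / (2 * (r 2 + r 3))) ^ 2 = 3 / 4 := by
        rw [div_pow, hκ]; simp [hr]; norm_num
      rw [hdisc, hc, ← volume_disc_inter_sixth hk, ← hc, ← hdisc]
      push_cast
      congr 2
      ext p
      simp only [fdom, Set.mem_inter_iff, Set.mem_ofPred_eq, absSqShift]
      constructor
      · rintro ⟨a, b, c, d⟩
        exact ⟨⟨a, by linarith⟩, d⟩
      · rintro ⟨⟨a, b⟩, d⟩
        exact ⟨a, by linarith, hre p (hmono hs a), d⟩
  have hre' : ∀ p, 0 ≤ depthFun r p → -1 / 2 ≤ p.re := by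
    intro p hp
    have h1 := (re_bounds hform hw hp).1
    have a3 : (r 3 + 1 : ℝ) ≤ r 2 := by exact_mod_cast h23
    by_contra hcon
    have : 0 < (r 2 + r 3 : ℝ) * (-1 / 2 - p.re) := mul_pos hw' (sub_pos.2 (not_le.1 hcon))
    linarith
  have hne0 : W.toWord ≠ [0] := by
    intro h
    rw [hzero h] at h23
    simp at h23
  rcases h12.eq_or_lt with h12 | h12
  · refine ⟨2, by norm_num, ?_, fun s hs => ?_⟩
    · rw [aCoeff, if_neg hne0, if_pos (hchain h12.symm hne0)]; norm_num
    · have hk : (-r 3 / (r 2 + r 3) : ℝ) ^ 2 + (κ / (2 * (r 2 + r 3))) ^ 2 = 1 := by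
        have hw1 : (r 1 + r 3 : ℝ) ≠ 0 := by rw [← h12]; exact hw'.ne'
        rw [div_pow, div_pow, hκ, hq, h12]
        field_simp
        ring
      rw [hdisc, ← volume_disc_inter_half hk, ← hdisc]
      push_cast
      congr 2
      ext p
      simp only [fdom, Set.mem_inter_iff, Set.mem_ofPred_eq]
      constructor
      · rintro ⟨a, b, c, d⟩
        exact ⟨a, d⟩
      · rintro ⟨a, d⟩
        exact ⟨a, hre' p (hmono hs a), hre p (hmono hs a), d⟩
  · refine ⟨1, by norm_num, ?_, fun s hs => ?_⟩
    · rw [aCoeff, if_neg hne0, if_neg]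
      · norm_num
      · rintro ⟨k, -, hk⟩
        have hmem : ∀ a ∈ (List.replicate k [(3 : Fin 4), 0]).flatten, a = 0 ∨ a = 3 := by
          intro a ha
          obtain ⟨l, hl, hal⟩ := List.mem_flatten.1 ha
          rw [List.eq_of_mem_replicate hl] at hal
          simpa [or_comm] using hal
        refine h12.ne' (hletters ?_)
        rcases hk with hk | hk <;> rw [hk]
        · exact hmem
        · intro a ha
          rcases List.mem_cons.1 ha with rfl | ha
          · exact Or.inl rfl
          · exact hmem a ha
    · rw [Nat.cast_one, one_mul, Set.inter_eq_left.2]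
      intro p hp
      have hp0 := hmono hs hp
      exact ⟨hre' p hp0, hre p hp0, one_le_absSq_of_depthFun hform hw h12 hp0⟩

/-- The discs of `Id₃` and `Id₄` meet the closed domain at most in a corner, and that of `Id₁` is
empty. -/
lemma volume_depth_ident (j : Fin 4) (hj : j ≠ 1) :
    volume ({p | 0 ≤ depthFun (wordMat [] j) p} ∩ fdom) = 0 := by
  refine measure_mono_null ?_ (volume_re_eq 0)
  rintro p ⟨h0, h1, h2, h3⟩
  have hy := p.im_pos
  change p.re = 0
  rw [Set.mem_ofPred_eq, le_depthFun_iff] at h0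
  unfold absSq at h0
  fin_cases j
  · simp [wordMat] at h0
    linarith
  · exact absurd rfl hj
  · simp [wordMat] at h0
    nlinarith
  · simp [wordMat] at h0
    nlinarith

/-- The disc of `Id₂` is the horoball `y ≥ 1`. -/
lemma volume_depth_ident_one {s : ℝ} (hs : 0 ≤ s) (hs1 : s ≤ 1) :
    volume ({p | s ≤ depthFun (wordMat [] 1) p} ∩ fdom) = ENNReal.ofReal (1 / 2 * (1 - s)) := by
  have hset : ∀ p : ℍ, s ≤ depthFun (wordMat [] 1) p ↔ 1 ≤ (1 - s) * p.im := by
    intro p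
    rw [le_depthFun_iff]
    simp [wordMat]
  rcases hs1.eq_or_lt with rfl | hs1
  · rw [sub_self, mul_zero, ENNReal.ofReal_zero]
    convert measure_empty (μ := (volume : Measure ℍ))
    ext p
    simp only [Set.mem_inter_iff, Set.mem_ofPred_eq, hset]
    norm_num
  · have h1 : 0 < 1 - s := by linarith
    have := volume_fdom_inter_im_ge (c := 1 / (1 - s)) (by rw [le_div_iff₀ h1]; linarith)
    rw [one_div_one_div] at this
    rw [← this]
    congr 2
    ext p
    simp only [Set.mem_ofPred_eq, hset, div_le_iff₀ h1]
    rw [mul_comm]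

end ApollonianStaircase

end

open ApollonianStaircase in
theorem theorem6p1 (n : ℝ) (hn : 0 < n) (W : ApollonianStaircase.DepthElement) :
    MeasurableSet {p : ℍ | ApollonianStaircase.HasDepthElement (ApollonianStaircase.alpha n p) W} ∧
    (ProbabilityTheory.cond (volume : Measure ℍ) ApollonianStaircase.fdom).real
        {p : ℍ | ApollonianStaircase.HasDepthElement (ApollonianStaircase.alpha n p) W} =
      ApollonianStaircase.depthProb W ∧
    (volume (ApollonianStaircase.depthRegion W) ≠ 0 →
      pdf.IsUniform
        (fun p : ℍ => ApollonianStaircase.height (ApollonianStaircase.alpha n p))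
        (Set.Icc 0 (W.t - √(W.t ^ 2 - 1)))
        (ProbabilityTheory.cond (volume : Measure ℍ) (ApollonianStaircase.depthRegion W))
        volume) := by
  have hmeas := measurable_depthFun (wordMat W.toWord W.pos)
  have hreg : depthRegion W = {p | HasDepthElement (alpha n p) W} ∩ fdom := by
    ext p
    simp only [depthRegion, Set.mem_inter_iff, Set.mem_ofPred_eq, mem_depthCircle,
      hasDepthElement_alpha hn]
  have hprob : (cond (volume : Measure ℍ) fdom).real {p | HasDepthElement (alpha n p) W} =
      (volume (depthRegion W)).toReal / (Real.pi / 6) := by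
    rw [measureReal_def, cond_apply measurableSet_fdom, Set.inter_comm, ← hreg, volume_fdom,
      ENNReal.toReal_mul, ENNReal.toReal_inv, ENNReal.toReal_ofReal (by positivity)]
    ring
  have hMS : MeasurableSet {p | HasDepthElement (alpha n p) W} := by
    simp only [hasDepthElement_alpha hn]
    exact (measurableSet_le measurable_const hmeas).inter (MeasurableSet.const _)
  refine ⟨hMS, ?_⟩
  by_cases hvol : volume (depthRegion W) = 0
  · refine ⟨?_, fun h => absurd hvol h⟩
    rw [hprob, hvol, depthProb, if_pos hvol, ENNReal.toReal_zero, zero_div]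
  have hshort : IsShortestWordTo (wordMat W.toWord W.pos) W.toWord := by
    obtain ⟨p, hp⟩ := nonempty_of_measure_ne_zero hvol
    rw [hreg] at hp
    exact ((hasDepthElement_alpha hn p W).1 hp.1).2
  have hreg' : depthRegion W = {p | 0 ≤ depthFun (wordMat W.toWord W.pos) p} ∩ fdom := by
    rw [hreg]
    simp only [hasDepthElement_alpha hn, hshort, and_true]
  have hH : ∀ p, 0 ≤ depthFun (wordMat W.toWord W.pos) p →
      height (alpha n p) = depthFun (wordMat W.toWord W.pos) p := fun p hp =>
    height_alpha hn p _ _ hp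
  rw [hprob, depthProb, if_neg hvol, hreg']
  rw [hreg'] at hvol
  clear hprob hreg hMS hreg' hshort
  by_cases hne : W.toWord = []
  · obtain ⟨j, rfl⟩ : ∃ j, W = DepthElement.ident j := by
      cases W with
      | ident j => exact ⟨j, rfl⟩
      | word w h _ => exact absurd hne h
    obtain rfl : j = 1 := by
      by_contra hj
      exact hvol (volume_depth_ident j hj)
    -- here the upper end of the interval is `1 - √0`
    have ht : (DepthElement.ident 1).t = 1 := by
      rw [t_eq]
      simp [DepthElement.toWord, DepthElement.pos, wordMat]
    have hv : ∀ s ∈ Set.Icc (0 : ℝ) 1, volume ({p | s ≤ depthFun (wordMat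
        (DepthElement.ident 1).toWord (DepthElement.ident 1).pos) p} ∩ fdom) =
        ENNReal.ofReal (1 / 2 * (1 - s)) := fun s hs => volume_depth_ident_one hs.1 hs.2
    constructor
    · rw [if_pos rfl, hv 0 ⟨le_rfl, zero_le_one⟩, ENNReal.toReal_ofReal (by norm_num)]
      field_simp
      norm_num
    · intro _
      rw [ht, one_pow, sub_self, Real.sqrt_zero, sub_zero]
      exact uniform_of_volume_eq measurableSet_fdom hmeas (by norm_num) one_pos hv hH
  · obtain ⟨ht, ha, hv⟩ := volume_depth_of_word W hne hvol
    have hκ : 0 < √(W.t ^ 2 - 1) := Real.sqrt_pos.2 (by nlinarith)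
    have hκt : √(W.t ^ 2 - 1) < W.t := by
      rw [Real.sqrt_lt' (by linarith)]; linarith
    have hW : W ≠ DepthElement.ident 1 := by rintro rfl; exact hne rfl
    constructor
    · rw [if_neg hW, hv 0 ⟨le_rfl, by linarith⟩, ENNReal.toReal_ofReal]
      · field_simp
        ring
      · have := sub_pos.2 hκt
        rw [sub_zero]
        positivity
    · intro _
      exact uniform_of_volume_eq measurableSet_fdom hmeas (by positivity) (by linarith) hv hH
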